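/- Let $N$ be a finite nonempty set of $n$ firms and $E$ a finite nonempty set of markets. Each firm $i$ chooses a strategy $\mathbf s_i=(s_{ix})_{x\in E}$ in the simplex $\Delta=\{\mathbf v\in\mathbb R^E : \mathbf v\ge 0,\ \sum_x v_x=1\}$. For each market $x$ the total payoff $u_x:[0,\infty)\to\mathbb R$ satisfies $u_x(0)=0$ and is non-decreasing, differentiable (one-sidedly at $0$) and concave. With $s_x=\sum_{i} s_{ix}$ and $p_x(t)=u_x(t)/t$ for $t>0$, the payoff of firm $i$ is $u_i(\mathbf s)=\sum_{x} p_x(s_x)\,s_{ix}$ (a market with $s_x=0$ contributes $0$). Assume that, for every market $x$, either $u_x$ is strictly concave on $[0,\infty)$, or $n\ge 2$ and $p_x$ is strictly decreasing on $(0,\infty)$. Then this game has exactly one Nash equilibrium $\mathbf s^*=(\mathbf s_i^*)_{i\in N}$, and $\mathbf s^*$ is globally asymptotically stable under the gradient adjustment process $$\frac{\mathrm d\mathbf s_i}{\mathrm dt}=P_{T(\mathbf s_i)}\nabla_i u_i(\mathbf s),\qquad i\in N,$$ where $\nabla_i$ is the gradient with respect to $\mathbf s_i$ (with one-sided partial derivatives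 at $s_{ix}=0$), $T(\mathbf s_i)$ is the tangent cone of $\Delta$ at $\mathbf s_i$, and $P_{T(\mathbf s_i)}$ is the Euclidean projection onto it. That is, calling a trajectory any locally absolutely continuous $\mathbf s:[0,\infty)\to\Delta^N$ that satisfies these equations for almost every $t>0$: from every initial profile in $\Delta^N$ there starts a trajectory; for every $\varepsilon>0$ there is $\delta>0$ such that every trajectory starting within distance $\delta$ of $\mathbf s^*$ stays within distance $\varepsilon$ of $\mathbf s^*$ for all $t\ge 0$; and every trajectory converges to $\mathbf s^*$ as $t\to\infty$. -/

import Mathlib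

namespace MultiMarket

open Set Filter Topology MeasureTheory

/-- Admissible total payoff `f(s)`, `s ≥ 0`, of a single market: it vanishes at `0` and is
non-decreasing, differentiable (from the right at `0`) and concave on `[0, ∞)`. -/
structure IsMarketPayoff (f : ℝ → ℝ) : Prop where
  map_zero : f 0 = 0
  monotoneOn : MonotoneOn f (Ici 0)
  differentiableOn : DifferentiableOn ℝ f (Ici 0)
  concaveOn : ConcaveOn ℝ (Ici 0) f

section Game

variable {N E : Type*} [Fintype N] [DecidableEq N] [Fintype E] [DecidableEq E]

/-- The strategy space of a firm: the standard simplex, as a subset of the Euclidean space on the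
set `E` of markets. -/
def strategySpace (E : Type*) [Fintype E] : Set (EuclideanSpace ℝ E) :=
  {v | (fun x => v x) ∈ stdSimplex ℝ E}

/-- Strategy profiles: every firm plays a point of the simplex. -/
def profiles (N E : Type*) [Fintype E] : Set (N → EuclideanSpace ℝ E) :=
  {s | ∀ i, s i ∈ strategySpace E}

/-- Aggregate investment of the opponents of firm `i` in each market. -/
def opponents (s : N → EuclideanSpace ℝ E) (i : N) : E → ℝ :=
  fun x => ∑ j ∈ Finset.univ.erase i, s j x

/-- Payoff of a firm that invests `v` when its opponents invest `c` in the aggregate: in each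
market `x` it earns the payoff per investment `u x (v x + c x) / (v x + c x)` times its own
investment `v x`. (In a market without any investment, this is `0`.) -/
noncomputable def payoff (u : E → ℝ → ℝ) (v c : E → ℝ) : ℝ :=
  ∑ x, u x (v x + c x) / (v x + c x) * v x

/-- The gradient of `payoff` in the firm's own strategy `v`, as the vector of its partial
derivatives. Investments are non-negative, so the partial derivative at `v x = 0` is one-sided. -/
noncomputable def payoffGradient (u : E → ℝ → ℝ) (v c : E → ℝ) : EuclideanSpace ℝ E :=
  WithLp.toLp 2 fun x =>
    derivWithin (fun t => payoff u (Function.update v x t) c) (Ici 0) (v x)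

/-- Nash equilibrium in pure strategies. -/
def IsNashEquilibrium (u : E → ℝ → ℝ) (s : N → EuclideanSpace ℝ E) : Prop :=
  s ∈ profiles N E ∧ ∀ i, ∀ v ∈ strategySpace E,
    payoff u (fun x => v x) (opponents s i) ≤ payoff u (fun x => s i x) (opponents s i)

/-- `v` is the metric projection of `g` onto `T`: the point of `T` nearest to `g`. -/
def IsMetricProjection {F : Type*} [PseudoMetricSpace F] (T : Set F) (g v : F) : Prop :=
  v ∈ T ∧ ∀ w ∈ T, dist g v ≤ dist g w

/-- `s : [0, ∞) → profiles` is a trajectory of the gradient adjustment process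
`ds_i/dt = P_{T(s_i)} ∇_i u_i(s)`, where `T(s_i)` is the tangent cone of the simplex at `s_i`. The
right-hand side is discontinuous at the relative boundary of the simplex, so solutions are taken in
the sense of Carathéodory: locally absolutely continuous, with the equation at almost every time.
Values of `s` at negative times play no role. -/
structure IsTrajectory (u : E → ℝ → ℝ) (s : ℝ → N → EuclideanSpace ℝ E) : Prop where
  mem_profiles : ∀ t, 0 ≤ t → s t ∈ profiles N E
  absolutelyContinuous : ∀ i, ∀ b, 0 ≤ b → AbsolutelyContinuousOnInterval (fun t => s t i) 0 b
  equation : ∀ᵐ t : ℝ, 0 < t → ∀ i, ∃ v : EuclideanSpace ℝ E,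
    IsMetricProjection (posTangentConeAt (strategySpace E) (s t i))
      (payoffGradient u (fun x => s t i x) (opponents (s t) i)) v ∧
    HasDerivAt (fun τ => s τ i) v t

end Game

/-- Global asymptotic stability of a point `p` for the dynamical system whose set of forward
trajectories `[0, ∞) → X` is `Traj`: `p` is Lyapunov stable, and every trajectory converges
to `p`. -/
def IsGloballyAsymptoticallyStable {X : Type*} [PseudoMetricSpace X] (Traj : Set (ℝ → X))
    (p : X) : Prop :=
  (∀ ε > 0, ∃ δ > 0, ∀ s ∈ Traj, dist (s 0) p < δ → ∀ t, 0 ≤ t → dist (s t) p < ε) ∧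
  ∀ s ∈ Traj, Tendsto s atTop (𝓝 p)

end MultiMarket

/-!
The gradient field of this game need not be monotone, so uniqueness and stability do not follow from
Rosen's diagonal strict concavity. Instead the argument separates the differences between firms from
their common motion.

In a market with payoff `f`, derivative `D` and average payoff `P`, a firm investing `a` out of the
total `S` has the partial derivative `P S + (D S - P S) * (a / S)` (`marketGradient`). Total
investment being common to all firms, the gradients of two firms `i`, `j` differ by
`(D S - P S) / S * (s i - s j)` in each market, and `D < P` (`derivWithin_lt_average`) because the
average payoff is strictly decreasing. So `⟪∇ᵢ - ∇ⱼ, s i - s j⟫ < 0` unless `s i = s j`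
(`inner_profileGradient_sub_neg`): equilibria are symmetric, and along trajectories the function
`V₁ = ∑ ‖s i - s j‖²` decreases to `0`. Passing to the projected gradient preserves such
estimates, since what the projection onto the tangent cone removes is a normal vector of the simplex
(`IsMetricProjection.inner_le_zero`).

At a symmetric profile the partial derivative is `(1 - 1/n) * P S + D S / n`, strictly decreasing in
`S` (`strictAntiOn_symmetricGradient`). A symmetric equilibrium `p` therefore exists as the
maximizer of a separable potential (`exists_variational_solution`), and among the symmetric
profiles it is the only solution of the first-order conditions, which characterize the Nash
equilibria because payoffs are concave in a firm's own strategy (`isNashEquilibrium_iff`). Moreover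
`V₂ = ∑ ‖s i - p i‖²` decreases on symmetric profiles; by compactness it decreases, away from
`p`, wherever `V₁` is small. Together `V₁` and `V₂` give global asymptotic stability
(`isGloballyAsymptoticallyStable_of_cascade`).

Trajectories exist because the gradient field extends continuously to the boundary, the derivative
of a differentiable concave function being continuous: a pointwise limit of projected Euler schemes
satisfies `d/dt ‖s i - y‖² ≤ 2 ⟪∇ᵢ, s i - y⟫` for each strategy `y`, and where it is differentiable
this forces its velocity to be the projected gradient (`exists_projected_solution`).
-/

namespace MultiMarket

open Set Filter Topology MeasureTheory
open scoped RealInnerProductSpace NNReal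

/-! ### Projection onto tangent cones of convex sets -/

section Projection

variable {F : Type*} [NormedAddCommGroup F] [InnerProductSpace ℝ F] {K : Set F}

lemma smul_sub_mem_posTangentConeAt (hK : Convex ℝ K) {x z : F} (hx : x ∈ K) (hz : z ∈ K)
    {r : ℝ} (hr : 0 ≤ r) : r • (z - x) ∈ posTangentConeAt K x := by
  apply mem_posTangentConeAt_of_frequently_mem
  apply Eventually.frequently
  have h1 : ∀ᶠ t : ℝ in 𝓝[>] 0, t < 1 / (r + 1) :=
    nhdsWithin_le_nhds (gt_mem_nhds (by positivity))
  filter_upwards [h1, self_mem_nhdsWithin] with t ht ht0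
  have ht0 : 0 < t := ht0
  have h2 : t * (r + 1) < 1 := by rwa [lt_div_iff₀ (by positivity)] at ht
  rw [smul_smul]
  exact hK.add_smul_sub_mem hx hz ⟨by positivity, by nlinarith⟩

/-- The tangent cone lies in the closure of the cone generated by `K - x`. -/
lemma mem_closure_of_mem_posTangentConeAt {x v : F} (hv : v ∈ posTangentConeAt K x) :
    v ∈ closure {w | ∃ r : ℝ, 0 ≤ r ∧ ∃ z ∈ K, w = r • (z - x)} := by
  obtain ⟨α, l, hl, c, d, -, hd, hcd⟩ := exists_fun_of_mem_tangentConeAt hv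
  refine mem_closure_of_tendsto hcd ?_
  filter_upwards [hd] with n hn
  exact ⟨c n, (c n).2, x + d n, hn, by simp [NNReal.smul_def]⟩

/-- Subtracting from `g` its projection `v` onto the tangent cone leaves a normal vector of the
convex set. -/
lemma IsMetricProjection.inner_le_zero (hK : Convex ℝ K) {x y g v : F} (hx : x ∈ K) (hy : y ∈ K)
    (h : IsMetricProjection (posTangentConeAt K x) g v) : ⟪g - v, y - x⟫ ≤ 0 := by
  set C : Set F := {w | ∃ r : ℝ, 0 ≤ r ∧ ∃ z ∈ K, w = r • (z - x)}
  have hCT : ∀ w ∈ C, w ∈ posTangentConeAt K x := by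
    rintro _ ⟨r, hr, z, hz, rfl⟩
    exact smul_sub_mem_posTangentConeAt hK hx hz hr
  have hCadd : ∀ w ∈ C, ∀ ε : ℝ, 0 < ε → w + ε • (y - x) ∈ C := by
    rintro _ ⟨r, hr, z, hz, rfl⟩ ε hε
    have hpos : 0 < r + ε := by positivity
    refine ⟨r + ε, hpos.le, (r / (r + ε)) • z + (ε / (r + ε)) • y,
      hK hz hy (by positivity) (by positivity) (by field_simp), ?_⟩
    rw [smul_sub (r + ε), smul_add, smul_smul, smul_smul, mul_div_cancel₀ _ hpos.ne',
      mul_div_cancel₀ _ hpos.ne', smul_sub, smul_sub, add_smul]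
    abel
  -- The cone generated by `K - x` is dense in the tangent cone, and stable under adding `y - x`.
  have key : ∀ ε : ℝ, 0 < ε → ‖g - v‖ ≤ ‖g - (v + ε • (y - x))‖ := by
    intro ε hε
    have hclosed : IsClosed {w : F | dist g v ≤ dist g (w + ε • (y - x))} :=
      isClosed_le continuous_const (by fun_prop)
    have := hclosed.closure_subset_iff.2
      (fun w hw => h.2 _ (hCT _ (hCadd w hw ε hε))) (mem_closure_of_mem_posTangentConeAt h.1)
    simpa [dist_eq_norm] using this
  have hlim : ∀ ε : ℝ, 0 < ε → 2 * ⟪g - v, y - x⟫ ≤ ε * ‖y - x‖ ^ 2 := by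
    intro ε hε
    have h1 := pow_le_pow_left₀ (norm_nonneg _) (key ε hε) 2
    rw [← sub_sub, norm_sub_sq_real (g - v), inner_smul_right, norm_smul, mul_pow, Real.norm_eq_abs,
      sq_abs] at h1
    have : ε * (2 * ⟪g - v, y - x⟫) ≤ ε * (ε * ‖y - x‖ ^ 2) := by nlinarith
    exact le_of_mul_le_mul_left this hε
  have h0 : Tendsto (fun ε : ℝ => ε * ‖y - x‖ ^ 2) (𝓝[>] 0) (𝓝 0) := by
    have : Tendsto (fun ε : ℝ => ε * ‖y - x‖ ^ 2) (𝓝 0) (𝓝 (0 * ‖y - x‖ ^ 2)) :=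
      Continuous.tendsto (by fun_prop) 0
    rw [zero_mul] at this
    exact this.mono_left nhdsWithin_le_nhds
  have := ge_of_tendsto h0 (by filter_upwards [self_mem_nhdsWithin] with ε hε using hlim ε hε)
  linarith

/-- A tangent vector `v` for which `g - v` is normal to `K` and orthogonal to `v` is the projection
of `g` onto the tangent cone (Moreau's decomposition). -/
lemma isMetricProjection_of_inner {x g v : F} (hv : v ∈ posTangentConeAt K x)
    (hn : ∀ y ∈ K, ⟪g - v, y - x⟫ ≤ 0) (ho : 0 ≤ ⟪g - v, v⟫) :
    IsMetricProjection (posTangentConeAt K x) g v := by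
  refine ⟨hv, fun w hw => ?_⟩
  have hw' : ⟪g - v, w⟫ ≤ 0 := by
    have hclosed : IsClosed {w : F | ⟪g - v, w⟫ ≤ 0} := isClosed_le (by fun_prop) continuous_const
    refine hclosed.closure_subset_iff.2 ?_ (mem_closure_of_mem_posTangentConeAt hw)
    rintro _ ⟨r, hr, z, hz, rfl⟩
    rw [mem_ofPred_eq, inner_smul_right]
    exact mul_nonpos_of_nonneg_of_nonpos hr (hn z hz)
  rw [dist_eq_norm, dist_eq_norm]
  rw [← pow_le_pow_iff_left₀ (norm_nonneg _) (norm_nonneg _) two_ne_zero,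
    show g - w = (g - v) + (v - w) by abel, norm_add_sq_real, inner_sub_right]
  nlinarith [sq_nonneg ‖v - w‖]

/-- One step of the projected Euler scheme: it moves by at most `h ‖g‖`, and the squared distance
to any point `y` of `K` changes at most as along the unprojected field, up to second order. -/
lemma projected_step {x x' y g : F} {h : ℝ} (hh : 0 ≤ h) (hx : x ∈ K) (hy : y ∈ K)
    (hp : ∀ w ∈ K, ⟪x + h • g - x', w - x'⟫ ≤ 0) :
    ‖x' - x‖ ≤ h * ‖g‖ ∧
      ‖x' - y‖ ^ 2 ≤ ‖x - y‖ ^ 2 + 2 * h * (⟪g, x - y⟫ + h * ‖g‖ ^ 2) := by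
  have e1 : x + h • g - x' = h • g - (x' - x) := by abel
  have h1 : ‖x' - x‖ ≤ h * ‖g‖ := by
    have h2 := hp x hx
    rw [e1, ← neg_sub x' x, inner_neg_right, inner_sub_left, inner_smul_left,
      real_inner_self_eq_norm_sq] at h2
    have h3 := real_inner_le_norm g (x' - x)
    simp only [conj_trivial] at h2
    have h4 : ‖x' - x‖ * ‖x' - x‖ ≤ (h * ‖g‖) * ‖x' - x‖ := by nlinarith
    by_contra hlt
    push Not at hlt
    have : 0 ≤ h * ‖g‖ := by positivity
    nlinarith
  refine ⟨h1, ?_⟩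
  have h2 := hp y hy
  have e2 : y - x' = -((x' - x) + (x - y)) := by abel
  have e3 : x' - y = (x' - x) + (x - y) := by abel
  rw [e1, e2, inner_neg_right, inner_sub_left, inner_smul_left, inner_add_right, inner_add_right,
    real_inner_self_eq_norm_sq] at h2
  simp only [conj_trivial] at h2
  rw [e3, norm_add_sq_real]
  have h3 := real_inner_le_norm g (x' - x)
  have h4 : ‖g‖ * ‖x' - x‖ ≤ ‖g‖ * (h * ‖g‖) := by gcongr
  have h5 : h * ⟪g, x' - x⟫ ≤ h * (h * ‖g‖ ^ 2) := by
    apply mul_le_mul_of_nonneg_left _ hh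
    nlinarith
  nlinarith [sq_nonneg ‖x' - x‖]

end Projection

/-! ### Existence of solutions of projected dynamical systems -/

section Existence

variable {N F : Type*} [NormedAddCommGroup F] [InnerProductSpace ℝ F]
  {K : Set F}

/-- The projected Euler scheme with step `h` for the field `G`, where `π` is the projection onto
the constraint set of each coordinate. -/
noncomputable def euler (π : F → F) (G : N → (N → F) → F) (s₀ : N → F) (h : ℝ) : ℕ → N → F
  | 0 => s₀
  | k + 1 => fun i => π (euler π G s₀ h k i + h • G i (euler π G s₀ h k))

lemma euler_mem {π : F → F} (hπ : ∀ x, π x ∈ K) (G : N → (N → F) → F) {s₀ : N → F}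
    (hs₀ : s₀ ∈ Set.pi univ fun _ : N => K) (h : ℝ) (k : ℕ) :
    euler π G s₀ h k ∈ Set.pi univ fun _ : N => K := by
  cases k with
  | zero => exact hs₀
  | succ k => exact fun i _ => hπ _

section

variable {π : F → F} {G : N → (N → F) → F} {s₀ : N → F} {M h : ℝ}

lemma euler_norm_sub_le (hπ : ∀ x, π x ∈ K) (hπ' : ∀ x, ∀ w ∈ K, ⟪x - π x, w - π x⟫ ≤ 0)
    (hs₀ : s₀ ∈ Set.pi univ fun _ : N => K)
    (hM : ∀ i, ∀ s ∈ Set.pi univ fun _ : N => K, ‖G i s‖ ≤ M) (hh : 0 ≤ h)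
    {k l : ℕ} (hkl : k ≤ l) (i : N) :
    ‖euler π G s₀ h l i - euler π G s₀ h k i‖ ≤ h * M * ((l : ℝ) - k) := by
  induction l, hkl using Nat.le_induction with
  | base => simp
  | succ l hl ih =>
    have hmem := euler_mem hπ G hs₀ h l
    have h1 := (projected_step hh (hmem i trivial) (hmem i trivial)
      (hπ' (euler π G s₀ h l i + h • G i (euler π G s₀ h l)))).1
    have h2 : h * ‖G i (euler π G s₀ h l)‖ ≤ h * M := by gcongr; exact hM i _ hmem
    have h3 := norm_sub_le_norm_sub_add_norm_sub (euler π G s₀ h (l + 1) i) (euler π G s₀ h l i)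
      (euler π G s₀ h k i)
    have h4 : ‖euler π G s₀ h (l + 1) i - euler π G s₀ h l i‖ ≤ h * ‖G i (euler π G s₀ h l)‖ := h1
    push_cast
    linarith

lemma euler_norm_sub_le_abs (hπ : ∀ x, π x ∈ K) (hπ' : ∀ x, ∀ w ∈ K, ⟪x - π x, w - π x⟫ ≤ 0)
    (hs₀ : s₀ ∈ Set.pi univ fun _ : N => K)
    (hM : ∀ i, ∀ s ∈ Set.pi univ fun _ : N => K, ‖G i s‖ ≤ M) (hh : 0 ≤ h)
    (k l : ℕ) (i : N) :
    ‖euler π G s₀ h l i - euler π G s₀ h k i‖ ≤ h * M * |(l : ℝ) - k| := by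
  rcases le_total k l with hkl | hkl
  · rw [abs_of_nonneg (sub_nonneg.2 (by exact_mod_cast hkl))]
    exact euler_norm_sub_le hπ hπ' hs₀ hM hh hkl i
  · rw [norm_sub_rev, abs_sub_comm, abs_of_nonneg (sub_nonneg.2 (by exact_mod_cast hkl))]
    exact euler_norm_sub_le hπ hπ' hs₀ hM hh hkl i

lemma euler_energy_le (hπ : ∀ x, π x ∈ K) (hπ' : ∀ x, ∀ w ∈ K, ⟪x - π x, w - π x⟫ ≤ 0)
    (hs₀ : s₀ ∈ Set.pi univ fun _ : N => K)
    (hM : ∀ i, ∀ s ∈ Set.pi univ fun _ : N => K, ‖G i s‖ ≤ M) (hh : 0 ≤ h)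
    {y : F} (hy : y ∈ K) (i : N) {C : ℝ} {k l : ℕ} (hkl : k ≤ l)
    (hC : ∀ m, k ≤ m → m < l → ⟪G i (euler π G s₀ h m), euler π G s₀ h m i - y⟫ ≤ C) :
    ‖euler π G s₀ h l i - y‖ ^ 2 ≤
      ‖euler π G s₀ h k i - y‖ ^ 2 + 2 * (h * ((l : ℝ) - k)) * (C + h * M ^ 2) := by
  induction l, hkl using Nat.le_induction with
  | base => simp
  | succ l hl ih =>
    have hmem := euler_mem hπ G hs₀ h l
    have ih := ih fun m hm hml => hC m hm (hml.trans (Nat.lt_succ_self l))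
    have h1 : ‖euler π G s₀ h (l + 1) i - y‖ ^ 2 ≤ _ := (projected_step hh (hmem i trivial) hy
      (hπ' (euler π G s₀ h l i + h • G i (euler π G s₀ h l)))).2
    have h2 : h * ‖G i (euler π G s₀ h l)‖ ^ 2 ≤ h * M ^ 2 := by gcongr; exact hM i _ hmem
    have h3 := hC l hl (Nat.lt_succ_self l)
    have h4 : 2 * h * (⟪G i (euler π G s₀ h l), euler π G s₀ h l i - y⟫ +
        h * ‖G i (euler π G s₀ h l)‖ ^ 2) ≤ 2 * h * (C + h * M ^ 2) := by gcongr
    push_cast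
    linarith

end

lemma abs_natFloor_sub_le (a b : ℝ) : |((⌊a⌋₊ : ℝ) - ⌊b⌋₊)| ≤ |a - b| + 1 := by
  wlog hab : b ≤ a generalizing a b
  · rw [abs_sub_comm, abs_sub_comm a]
    exact this b a (le_of_not_ge hab)
  have h0 : (⌊b⌋₊ : ℝ) ≤ ⌊a⌋₊ := by exact_mod_cast Nat.floor_mono hab
  rw [abs_of_nonneg (by linarith), abs_of_nonneg (by linarith)]
  rcases le_total 0 a with ha | ha
  · have := Nat.floor_le ha
    have := Nat.lt_floor_add_one b
    linarith
  · rw [Nat.floor_of_nonpos ha, Nat.floor_of_nonpos (hab.trans ha)]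
    simp
    linarith

/-- A limit of projected Euler schemes for a continuous field: a Lipschitz curve in the
constraint set, along which the squared distance to each point `y` of the constraint set increases
at most at the rate `2 ⟪G i s, s i - y⟫`. The limit is taken pointwise along an ultrafilter, which
makes an equicontinuity argument unnecessary. -/
lemma exists_limit_euler [Fintype N] (hK : IsCompact K) (hconv : Convex ℝ K) {G : N → (N → F) → F}
    (hG : ∀ i, ContinuousOn (G i) (Set.pi univ fun _ : N => K)) {s₀ : N → F}
    (hs₀ : s₀ ∈ Set.pi univ fun _ : N => K) :
    ∃ s : ℝ → N → F, s 0 = s₀ ∧ (∀ t, s t ∈ Set.pi univ fun _ : N => K) ∧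
      (∃ M : ℝ≥0, ∀ i, LipschitzWith M fun t => s t i) ∧
      ∀ t, 0 ≤ t → ∀ i, ∀ y ∈ K, ∀ ε > 0, ∀ᶠ τ in 𝓝[>] t,
        ‖s τ i - y‖ ^ 2 ≤ ‖s t i - y‖ ^ 2 + 2 * (τ - t) * (⟪G i (s t), s t i - y⟫ + ε) := by
  rcases isEmpty_or_nonempty N with hN | ⟨⟨i₀⟩⟩
  · exact ⟨fun _ => s₀, rfl, fun _ => hs₀, ⟨0, fun i => hN.elim i⟩, fun _ _ i => hN.elim i⟩
  have hne : K.Nonempty := ⟨s₀ i₀, hs₀ i₀ trivial⟩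
  have hpi : IsCompact (Set.pi univ fun _ : N => K) := isCompact_univ_pi fun _ => hK
  have hproj : ∀ x : F, ∃ z ∈ K, ∀ w ∈ K, ⟪x - z, w - z⟫ ≤ 0 := by
    intro x
    obtain ⟨z, hz, hxz⟩ := exists_norm_eq_iInf_of_complete_convex hne hK.isComplete hconv x
    exact ⟨z, hz, (norm_eq_iInf_iff_real_inner_le_zero hconv hz).1 hxz⟩
  choose π hπ hπ' using hproj
  obtain ⟨M, hM0, hM⟩ : ∃ M : ℝ, 0 < M ∧ ∀ i, ∀ s ∈ Set.pi univ fun _ : N => K, ‖G i s‖ ≤ M := by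
    choose B hB using fun i => hpi.exists_bound_of_continuousOn (hG i)
    refine ⟨1 + ∑ i, |B i|, by positivity, fun i s hs => (hB i s hs).trans ?_⟩
    have := Finset.single_le_sum (f := fun i => |B i|) (fun i _ => abs_nonneg _) (Finset.mem_univ i)
    have := le_abs_self (B i)
    linarith
  set H : ℕ → ℝ := fun n => 1 / ((n : ℝ) + 1) with hH
  have hHpos : ∀ n, 0 < H n := fun n => by positivity
  set X : ℕ → ℕ → N → F := fun n => euler π G s₀ (H n) with hX
  set f : ℕ → ℝ → N → F := fun n t => X n ⌊t * ((n : ℝ) + 1)⌋₊ with hf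
  have hXmem : ∀ n k, X n k ∈ Set.pi univ fun _ : N => K := fun n k => euler_mem hπ G hs₀ _ k
  have hlim : ∀ t, ∃ x ∈ Set.pi univ fun _ : N => K,
      Tendsto (fun n => f n t) (hyperfilter ℕ) (𝓝 x) := fun t =>
    hpi.ultrafilter_le_nhds ((hyperfilter ℕ).map fun n => f n t)
      (tendsto_principal.2 (Eventually.of_forall fun n => hXmem n _))
  choose s hs hfs using hlim
  have hfs' : ∀ t i, Tendsto (fun n => f n t i) (hyperfilter ℕ) (𝓝 (s t i)) := fun t i =>
    (tendsto_pi_nhds.1 (hfs t)) i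
  have hH0 : Tendsto H (hyperfilter ℕ) (𝓝 0) :=
    tendsto_one_div_add_atTop_nhds_zero_nat.mono_left Nat.hyperfilter_le_atTop
  have hfloor : ∀ t, 0 ≤ t →
      Tendsto (fun n => H n * (⌊t * ((n : ℝ) + 1)⌋₊ : ℝ)) (hyperfilter ℕ) (𝓝 t) := by
    intro t ht
    have h1 : Tendsto (fun n : ℕ => (n : ℝ) + 1) atTop atTop :=
      tendsto_atTop_add_const_right _ _ tendsto_natCast_atTop_atTop
    have h2 := ((tendsto_nat_floor_mul_div_atTop ht).comp h1).mono_left Nat.hyperfilter_le_atTop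
    refine h2.congr fun n => ?_
    simp only [Function.comp, hH]
    ring
  have hflip : ∀ n t τ i, ‖f n t i - f n τ i‖ ≤ M * (|t - τ| + H n) := by
    intro n t τ i
    refine (euler_norm_sub_le_abs hπ hπ' hs₀ hM (hHpos n).le _ _ i).trans ?_
    have h1 := abs_natFloor_sub_le (t * ((n : ℝ) + 1)) (τ * ((n : ℝ) + 1))
    rw [← sub_mul, abs_mul, abs_of_pos (by positivity : (0 : ℝ) < (n : ℝ) + 1)] at h1
    calc H n * M * _ ≤ H n * M * (|t - τ| * ((n : ℝ) + 1) + 1) := by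
          gcongr
      _ = M * (|t - τ| + H n) := by
          simp only [hH]
          field_simp
  refine ⟨s, ?_, hs, ⟨M.toNNReal, fun i => ?_⟩, ?_⟩
  · refine tendsto_nhds_unique (hfs 0) ?_
    have : ∀ n, f n 0 = s₀ := fun n => by simp [hf, hX, euler]
    simp only [this]
    exact tendsto_const_nhds
  · refine LipschitzWith.of_dist_le_mul fun t τ => ?_
    rw [dist_eq_norm, Real.dist_eq, Real.coe_toNNReal _ hM0.le]
    refine le_of_tendsto_of_tendsto ((hfs' t i).sub (hfs' τ i)).norm
      (?_ : Tendsto (fun n => M * (|t - τ| + H n)) _ _)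
      (Eventually.of_forall fun n => hflip n t τ i)
    simpa using (hH0.const_add |t - τ|).const_mul M
  · intro t ht i y hy ε hε
    have hΦ : ContinuousOn (fun x : N → F => ⟪G i x, x i - y⟫) (Set.pi univ fun _ : N => K) :=
      (hG i).inner (by fun_prop)
    obtain ⟨η, hη, hηΦ⟩ := Metric.continuousOn_iff.1 hΦ (s t) (hs t) ε hε
    have hδ : t < t + η / (4 * M) := by linarith [show 0 < η / (4 * M) by positivity]
    filter_upwards [Ioo_mem_nhdsGT hδ] with τ hτ
    have hτt : t < τ := hτ.1
    have hτ1 : M * (τ - t) < η / 4 := by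
      have : τ - t < η / (4 * M) := by linarith [hτ.2]
      calc M * (τ - t) < M * (η / (4 * M)) := by gcongr
        _ = η / 4 := by field_simp
    -- For fine steps, the scheme stays within `η` of `s t` during the time interval `[t, τ]`.
    have hev : ∀ᶠ n in (hyperfilter ℕ : Filter ℕ), ‖f n τ i - y‖ ^ 2 ≤ ‖f n t i - y‖ ^ 2 +
        2 * (H n * (⌊τ * ((n : ℝ) + 1)⌋₊ : ℝ) - H n * (⌊t * ((n : ℝ) + 1)⌋₊ : ℝ)) *
          ((⟪G i (s t), s t i - y⟫ + ε) + H n * M ^ 2) := by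
      have hclose : ∀ᶠ n in (hyperfilter ℕ : Filter ℕ), dist (f n t) (s t) < η / 4 :=
        (tendsto_iff_dist_tendsto_zero.1 (hfs t)).eventually (gt_mem_nhds (by positivity))
      have hsmall : ∀ᶠ n in (hyperfilter ℕ : Filter ℕ), H n < η / (4 * M) :=
        hH0.eventually (gt_mem_nhds (by positivity))
      filter_upwards [hclose, hsmall] with n hn1 hn2
      have hkl : ⌊t * ((n : ℝ) + 1)⌋₊ ≤ ⌊τ * ((n : ℝ) + 1)⌋₊ := by gcongr
      rw [← mul_sub]
      refine euler_energy_le hπ hπ' hs₀ hM (hHpos n).le hy i hkl fun m hkm hml => ?_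
      have hn3 : M * H n < η / 4 := by
        calc M * H n < M * (η / (4 * M)) := by gcongr
          _ = η / 4 := by field_simp
      have hd : dist (X n m) (s t) < η := by
        have h1 : dist (X n m) (f n t) ≤ η / 2 := by
          refine (dist_pi_le_iff (by positivity)).2 fun j => ?_
          rw [dist_eq_norm]
          refine (euler_norm_sub_le hπ hπ' hs₀ hM (hHpos n).le hkm j).trans ?_
          have h2 : (m : ℝ) ≤ ⌊τ * ((n : ℝ) + 1)⌋₊ := by exact_mod_cast hml.le
          have h3 := abs_natFloor_sub_le (τ * ((n : ℝ) + 1)) (t * ((n : ℝ) + 1))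
          rw [← sub_mul, abs_mul, abs_of_pos (by positivity : (0 : ℝ) < (n : ℝ) + 1),
            abs_of_pos (sub_pos.2 hτt)] at h3
          have h4 := (le_abs_self _).trans h3
          calc H n * M * _ ≤ H n * M * ((τ - t) * ((n : ℝ) + 1) + 1) := by
                gcongr
                linarith
            _ = M * (τ - t) + M * H n := by
                simp only [hH]
                field_simp
            _ ≤ η / 2 := by linarith
        linarith [dist_triangle (X n m) (f n t) (s t)]
      have h5 := hηΦ (X n m) (hXmem n m) hd
      rw [Real.dist_eq] at h5
      linarith [(abs_lt.1 h5).2]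
    refine le_of_tendsto_of_tendsto (((hfs' τ i).sub_const y).norm.pow 2)
      (Tendsto.add (((hfs' t i).sub_const y).norm.pow 2) ?_) hev
    have h6 := (((hfloor τ (ht.trans hτt.le)).sub (hfloor t ht)).const_mul 2).mul
      ((hH0.mul_const (M ^ 2)).const_add (⟪G i (s t), s t i - y⟫ + ε))
    simpa using h6

/-- Existence for projected dynamical systems: a field that is continuous on a product of copies of
a compact convex set has a Lipschitz solution from every initial point. -/
theorem exists_projected_solution [Fintype N] (hK : IsCompact K) (hconv : Convex ℝ K)
    {G : N → (N → F) → F}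
    (hG : ∀ i, ContinuousOn (G i) (Set.pi univ fun _ : N => K)) {s₀ : N → F}
    (hs₀ : s₀ ∈ Set.pi univ fun _ : N => K) :
    ∃ s : ℝ → N → F, s 0 = s₀ ∧ (∀ t, s t ∈ Set.pi univ fun _ : N => K) ∧
      (∃ M : ℝ≥0, ∀ i, LipschitzWith M fun t => s t i) ∧
      ∀ t, 0 ≤ t → ∀ i v, HasDerivAt (fun τ => s τ i) v t →
        IsMetricProjection (posTangentConeAt K (s t i)) (G i (s t)) v := by
  obtain ⟨s, hs0, hs, hlip, hen⟩ := exists_limit_euler hK hconv hG hs₀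
  refine ⟨s, hs0, hs, hlip, fun t ht i v hv => ?_⟩
  have hslope := (hasDerivAt_iff_tendsto_slope.1 hv)
  have hright : Tendsto (slope (fun τ => s τ i) t) (𝓝[>] t) (𝓝 v) :=
    hslope.mono_left (nhdsWithin_mono _ fun x hx => ne_of_gt hx)
  have hleft : Tendsto (slope (fun τ => s τ i) t) (𝓝[<] t) (𝓝 v) :=
    hslope.mono_left (nhdsWithin_mono _ fun x hx => ne_of_lt hx)
  have hnormal : ∀ y ∈ K, ⟪G i (s t) - v, y - s t i⟫ ≤ 0 := by
    intro y hy
    have hder : HasDerivAt (fun τ => ‖s τ i - y‖ ^ 2) (2 * ⟪s t i - y, v⟫) t :=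
      (hv.sub_const y).norm_sq
    have hder' : Tendsto (slope (fun τ => ‖s τ i - y‖ ^ 2) t) (𝓝[>] t)
        (𝓝 (2 * ⟪s t i - y, v⟫)) :=
      (hasDerivAt_iff_tendsto_slope.1 hder).mono_left
        (nhdsWithin_mono _ fun x hx => ne_of_gt hx)
    have hle : ⟪s t i - y, v⟫ ≤ ⟪G i (s t), s t i - y⟫ := by
      refine le_of_forall_pos_le_add fun ε hε => ?_
      have : 2 * ⟪s t i - y, v⟫ ≤ 2 * (⟪G i (s t), s t i - y⟫ + ε) := by
        refine le_of_tendsto hder' ?_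
        filter_upwards [hen t ht i y hy ε hε, self_mem_nhdsWithin] with τ h1 hτ
        have hτ : 0 < τ - t := sub_pos.2 hτ
        rw [slope_def_field, div_le_iff₀ hτ]
        linarith
      linarith
    have e : y - s t i = -(s t i - y) := by abel
    rw [e, inner_neg_right, inner_sub_left, real_inner_comm _ v]
    linarith
  have hvT : v ∈ posTangentConeAt K (s t i) := by
    refine mem_tangentConeAt_of_seq (𝓝[>] t) (fun τ => Real.toNNReal (τ - t)⁻¹)
      (fun τ => s τ i - s t i) ?_ (Eventually.of_forall fun τ => ?_) ?_
    · have : Tendsto (fun τ => s τ i - s t i) (𝓝 t) (𝓝 (s t i - s t i)) :=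
        (hv.continuousAt.tendsto).sub_const _
      rw [sub_self] at this
      exact this.mono_left nhdsWithin_le_nhds
    · rw [add_sub_cancel]
      exact hs τ i trivial
    · refine hright.congr' ?_
      filter_upwards [self_mem_nhdsWithin] with τ hτ
      have hτ : 0 < τ - t := sub_pos.2 hτ
      rw [NNReal.smul_def, Real.coe_toNNReal _ (by positivity), slope_def_module]
  -- The past values `s τ i`, `τ < t`, also lie in `K`, so `-v` is tangent as well.
  refine isMetricProjection_of_inner hvT hnormal ?_
  refine ge_of_tendsto ((tendsto_const_nhds (x := G i (s t) - v)).inner hleft) ?_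
  filter_upwards [self_mem_nhdsWithin] with τ hτ
  have hτ : τ - t < 0 := sub_neg.2 hτ
  rw [slope_def_module, inner_smul_right]
  exact mul_nonneg_of_nonpos_of_nonpos (inv_nonpos.2 hτ.le) (hnormal _ (hs τ i trivial))

end Existence

/-! ### Absolutely continuous Lyapunov functions -/

section Decay

lemma absolutelyContinuousOnInterval_norm {F : Type*} [NormedAddCommGroup F] [NormedSpace ℝ F]
    {f : ℝ → F} {a b : ℝ} (hf : AbsolutelyContinuousOnInterval f a b) :
    AbsolutelyContinuousOnInterval (fun t => ‖f t‖) a b := by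
  apply squeeze_zero (fun t => ?_) (fun t => ?_) hf
  · exact Finset.sum_nonneg fun i _ => dist_nonneg
  · exact Finset.sum_le_sum fun i _ =>
      (dist_norm_norm_le _ _).trans_eq (dist_eq_norm _ _).symm

lemma absolutelyContinuousOnInterval_norm_sq {F : Type*} [NormedAddCommGroup F] [NormedSpace ℝ F]
    {f : ℝ → F} {a b : ℝ} (hf : AbsolutelyContinuousOnInterval f a b) :
    AbsolutelyContinuousOnInterval (fun t => ‖f t‖ ^ 2) a b := by
  simp only [sq]
  exact (absolutelyContinuousOnInterval_norm hf).mul (absolutelyContinuousOnInterval_norm hf)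

lemma absolutelyContinuousOnInterval_sum {ι : Type*} {s : Finset ι} {f : ι → ℝ → ℝ} {a b : ℝ}
    (hf : ∀ i ∈ s, AbsolutelyContinuousOnInterval (f i) a b) :
    AbsolutelyContinuousOnInterval (fun t => ∑ i ∈ s, f i t) a b := by
  classical
  induction s using Finset.induction_on with
  | empty =>
    simp only [Finset.sum_empty]
    exact ((LipschitzWith.const (0 : ℝ)).lipschitzOnWith).absolutelyContinuousOnInterval
  | insert i s hi ih =>
    simp only [Finset.sum_insert hi]
    exact (hf i (Finset.mem_insert_self i s)).add
      (ih fun j hj => hf j (Finset.mem_insert_of_mem hj))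

/-- `V` is locally absolutely continuous on `[0, ∞)`, and its derivative is at most `w` at almost
every positive time. -/
def DerivAtMost (V w : ℝ → ℝ) : Prop :=
  (∀ b, 0 ≤ b → AbsolutelyContinuousOnInterval V 0 b) ∧
    ∀ᵐ t : ℝ, 0 < t → ∃ d ≤ w t, HasDerivAt V d t

variable {V w : ℝ → ℝ}

/-- The differential inequality, integrated. -/
lemma DerivAtMost.le_sub (h : DerivAtMost V w) {a b c : ℝ} (ha : 0 ≤ a) (hab : a ≤ b)
    (hw : ∀ t ∈ Ioo a b, w t ≤ -c) : V b ≤ V a - c * (b - a) := by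
  have hac : AbsolutelyContinuousOnInterval V a b := by
    refine (h.1 b (ha.trans hab)).mono ?_
    rw [uIcc_of_le hab, uIcc_of_le (ha.trans hab)]
    exact Icc_subset_Icc_left ha
  have h1 := hac.integral_deriv_eq_sub
  have h2 : ∫ t in a..b, deriv V t ≤ ∫ _ in a..b, -c := by
    refine intervalIntegral.integral_mono_ae_restrict hab hac.intervalIntegrable_deriv
      intervalIntegrable_const ?_
    rw [← restrict_Ioo_eq_restrict_Icc]
    rw [EventuallyLE, ae_restrict_iff' measurableSet_Ioo]
    filter_upwards [h.2] with t ht htab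
    obtain ⟨d, hd, hV⟩ := ht (ha.trans_lt htab.1)
    rw [hV.deriv]
    exact hd.trans (hw t htab)
  rw [h1, intervalIntegral.integral_const, smul_eq_mul] at h2
  linarith

lemma DerivAtMost.continuousOn (h : DerivAtMost V w) {a b : ℝ} (ha : 0 ≤ a) :
    ContinuousOn V (Icc a b) := by
  rcases le_or_gt a b with hab | hab
  · have := (h.1 b (ha.trans hab)).continuousOn
    rw [uIcc_of_le (ha.trans hab)] at this
    exact this.mono (Icc_subset_Icc_left ha)
  · simp [Icc_eq_empty_of_lt hab]

/-- Sublevel sets are forward invariant if `V` does not increase outside of them. -/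
lemma DerivAtMost.le_of_le (h : DerivAtMost V w) {a b ε : ℝ} (ha : 0 ≤ a) (hab : a ≤ b)
    (hw : ∀ t, a ≤ t → ε < V t → w t ≤ 0) (hVa : V a ≤ ε) : V b ≤ ε := by
  by_contra! hlt
  have hcpt : IsCompact (Icc a b ∩ V ⁻¹' Iic ε) :=
    isCompact_Icc.of_isClosed_subset
      ((h.continuousOn ha).preimage_isClosed_of_isClosed isClosed_Icc isClosed_Iic)
      inter_subset_left
  -- The last time at which `V ≤ ε`.
  obtain ⟨τ, ⟨hτ, hVτ⟩, hmax⟩ := hcpt.exists_isGreatest ⟨a, left_mem_Icc.2 hab, hVa⟩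
  have hVτ : V τ ≤ ε := hVτ
  have := h.le_sub (c := 0) (ha.trans hτ.1) hτ.2 fun t ht => by
    rw [neg_zero]
    refine hw t (hτ.1.trans ht.1.le) ?_
    by_contra! hle
    exact (hmax ⟨⟨hτ.1.trans ht.1.le, ht.2.le⟩, hle⟩).not_gt ht.1
  linarith

/-- A non-negative `V` ends up in each sublevel set outside of which it decreases at a rate bounded
away from `0`. -/
lemma DerivAtMost.eventually_le (h : DerivAtMost V w) (hV : ∀ t, 0 ≤ t → 0 ≤ V t) {a ε c : ℝ}
    (ha : 0 ≤ a) (hc : 0 < c) (hw : ∀ t, a ≤ t → ε ≤ V t → w t ≤ -c) :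
    ∃ T, a ≤ T ∧ ∀ t, T ≤ t → V t ≤ ε := by
  obtain ⟨T, hT, hVT⟩ : ∃ T, a ≤ T ∧ V T ≤ ε := by
    by_contra! hlt
    have hVa := hV a ha
    have hT : a ≤ a + (V a / c + 1) := by linarith [show 0 ≤ V a / c by positivity]
    have h1 := h.le_sub (c := c) ha hT fun t ht => hw t ht.1.le (hlt t ht.1.le).le
    have h2 := hV _ (ha.trans hT)
    have h3 : c * (a + (V a / c + 1) - a) = V a + c := by field_simp; ring
    linarith
  exact ⟨T, hT, fun t ht => h.le_of_le (ha.trans hT) ht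
    (fun r hr hVr => (hw r (hT.trans hr) hVr.le).trans (by linarith)) hVT⟩

end Decay

section Cascade

variable {X : Type*} [MetricSpace X] {K : Set X}

/-- Positivity of `m` on the compact set `{s ∈ K | ε ≤ V s}` is uniform. -/
lemma exists_pos_forall_le {m V : X → ℝ} (hK : IsCompact K) (hm : ContinuousOn m K)
    (hV : ContinuousOn V K) {ε : ℝ} (h : ∀ s ∈ K, ε ≤ V s → 0 < m s) :
    ∃ c > 0, ∀ s ∈ K, ε ≤ V s → c ≤ m s := by
  have hZ : IsCompact (K ∩ V ⁻¹' Ici ε) :=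
    hK.of_isClosed_subset (hV.preimage_isClosed_of_isClosed hK.isClosed isClosed_Ici)
      inter_subset_left
  obtain ⟨c, hc, hcm⟩ := hZ.exists_forall_le' (hm.mono inter_subset_left)
    (a := 0) (fun s hs => h s hs.1 hs.2)
  exact ⟨c, hc, fun s hs hVs => hcm s ⟨hs, hVs⟩⟩

/-- A stability criterion with two functions in cascade: `V₁` decreases as long as it is positive,
while `V₂`, which controls the distance to `p`, is only known to decrease on the zero set of `V₁`.
By compactness `V₂` then decreases, away from its own zeros, at all points where `V₁` is small. -/
theorem isGloballyAsymptoticallyStable_of_cascade (hK : IsCompact K)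
    {V₁ V₂ W₁ W₂ : X → ℝ} (hV₁ : ContinuousOn V₁ K) (hV₂ : ContinuousOn V₂ K)
    (hW₁ : ContinuousOn W₁ K) (hW₂ : ContinuousOn W₂ K) {p : X} (hp : p ∈ K)
    (hV₁0 : ∀ s ∈ K, 0 ≤ V₁ s) (hV₁p : V₁ p = 0) (hV₂p : V₂ p = 0)
    (hdist : ∀ s ∈ K, dist s p ^ 2 ≤ V₂ s)
    (hneg₁ : ∀ s ∈ K, 0 < V₁ s → W₁ s < 0)
    (hneg₂ : ∀ s ∈ K, V₁ s = 0 → 0 < V₂ s → W₂ s < 0)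
    {Traj : Set (ℝ → X)} (hmem : ∀ s ∈ Traj, ∀ t, 0 ≤ t → s t ∈ K)
    (hder₁ : ∀ s ∈ Traj, DerivAtMost (fun t => V₁ (s t)) fun t => W₁ (s t))
    (hder₂ : ∀ s ∈ Traj, DerivAtMost (fun t => V₂ (s t)) fun t => W₂ (s t)) :
    IsGloballyAsymptoticallyStable Traj p := by
  have key₁ : ∀ ε > 0, ∃ c > 0, ∀ s ∈ K, ε ≤ V₁ s → W₁ s ≤ -c := by
    intro ε hε
    obtain ⟨c, hc, h⟩ := exists_pos_forall_le (ε := ε) hK hW₁.neg hV₁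
      fun s hs hVs => neg_pos.2 (hneg₁ s hs (hε.trans_le hVs))
    exact ⟨c, hc, fun s hs hVs => le_neg_of_le_neg (h s hs hVs)⟩
  have key₂ : ∀ ε > 0, ∃ η > 0, ∃ c > 0, ∀ s ∈ K, V₁ s ≤ η → ε ≤ V₂ s → W₂ s ≤ -c := by
    intro ε hε
    obtain ⟨c, hc, h⟩ := exists_pos_forall_le (m := fun s => max (V₁ s) (-W₂ s)) (ε := ε) hK
      (hV₁.sup hW₂.neg) hV₂ fun s hs hVs => by
        rcases (hV₁0 s hs).lt_or_eq with h1 | h1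
        · exact lt_max_of_lt_left h1
        · exact lt_max_of_lt_right (neg_pos.2 (hneg₂ s hs h1.symm (hε.trans_le hVs)))
    refine ⟨c / 2, by positivity, c, hc, fun s hs h1 h2 => ?_⟩
    -- As `V₁ s ≤ c / 2 < c`, the maximum is attained by `-W₂ s`.
    rcases le_max_iff.1 (h s hs h2) with h3 | h3
    · linarith
    · linarith
  have hdist' : ∀ ε > 0, ∀ s ∈ K, V₂ s ≤ ε ^ 2 / 4 → dist s p < ε := by
    intro ε hε s hs h
    have h1 : dist s p ^ 2 < ε ^ 2 := by nlinarith [hdist s hs]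
    exact lt_of_pow_lt_pow_left₀ 2 hε.le h1
  refine ⟨fun ε hε => ?_, fun s hs => ?_⟩
  · obtain ⟨η, hη, c, hc, hW⟩ := key₂ (ε ^ 2 / 4) (by positivity)
    obtain ⟨c₁, hc₁, hW'⟩ := key₁ η hη
    obtain ⟨δ₁, hδ₁, hV₁δ⟩ := Metric.continuousOn_iff.1 hV₁ p hp η hη
    obtain ⟨δ₂, hδ₂, hV₂δ⟩ := Metric.continuousOn_iff.1 hV₂ p hp (ε ^ 2 / 4) (by positivity)
    refine ⟨min δ₁ δ₂, lt_min hδ₁ hδ₂, fun s hs hs0 t ht => ?_⟩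
    have hmem0 := hmem s hs 0 le_rfl
    have h1 : V₁ (s 0) ≤ η := by
      have := hV₁δ _ hmem0 (hs0.trans_le (min_le_left _ _))
      rw [hV₁p, Real.dist_eq, sub_zero] at this
      exact (le_abs_self _).trans this.le
    have h2 : V₂ (s 0) ≤ ε ^ 2 / 4 := by
      have := hV₂δ _ hmem0 (hs0.trans_le (min_le_right _ _))
      rw [hV₂p, Real.dist_eq, sub_zero] at this
      exact (le_abs_self _).trans this.le
    have h3 : ∀ r, 0 ≤ r → V₁ (s r) ≤ η := fun r hr =>
      (hder₁ s hs).le_of_le le_rfl hr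
        (fun q hq hVq => (hW' _ (hmem s hs q hq) hVq.le).trans (by linarith)) h1
    refine hdist' ε hε _ (hmem s hs t ht) ?_
    exact (hder₂ s hs).le_of_le le_rfl ht (fun q hq hVq =>
      (hW _ (hmem s hs q hq) (h3 q hq) hVq.le).trans (by linarith)) h2
  · rw [Metric.tendsto_atTop]
    intro ε hε
    obtain ⟨η, hη, c, hc, hW⟩ := key₂ (ε ^ 2 / 4) (by positivity)
    obtain ⟨c₁, hc₁, hW'⟩ := key₁ η hη
    obtain ⟨T₁, hT₁, h1⟩ := (hder₁ s hs).eventually_le (fun t ht => hV₁0 _ (hmem s hs t ht))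
      le_rfl hc₁ fun t ht hVt => hW' _ (hmem s hs t ht) hVt
    obtain ⟨T₂, hT₂, h2⟩ := (hder₂ s hs).eventually_le
      (fun t ht => (sq_nonneg _).trans (hdist _ (hmem s hs t ht))) hT₁ hc
      fun t ht hVt => hW _ (hmem s hs t (hT₁.trans ht)) (h1 t ht) hVt
    exact ⟨T₂, fun t ht => hdist' ε hε _ (hmem s hs t (hT₁.trans (hT₂.trans ht))) (h2 t ht)⟩

end Cascade

/-! ### A single market -/

section Market

/-- The payoff per unit of investment, `f t / t`, extended to `t = 0` by the right derivative, which
makes it continuous on `[0, ∞)`. -/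
noncomputable def average (f : ℝ → ℝ) (t : ℝ) : ℝ :=
  if t = 0 then derivWithin f (Ici 0) 0 else f t / t

/-- The partial derivative of a firm's payoff in a single market with payoff function `f`, where the
firm invests `a` and all firms together invest `S`. For `S = 0` the second term vanishes. -/
noncomputable def marketGradient (f : ℝ → ℝ) (a S : ℝ) : ℝ :=
  average f S + (derivWithin f (Ici 0) S - average f S) * (a / S)

/-- The value of `marketGradient` at a profile in which each of `n` firms invests `S / n`. -/
noncomputable def symmetricGradient (n : ℕ) (f : ℝ → ℝ) (S : ℝ) : ℝ :=
  average f S + (derivWithin f (Ici 0) S - average f S) / n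

lemma average_zero (f : ℝ → ℝ) : average f 0 = derivWithin f (Ici 0) 0 := if_pos rfl

lemma average_of_pos (f : ℝ → ℝ) {t : ℝ} (ht : 0 < t) : average f t = f t / t := if_neg ht.ne'

lemma marketGradient_div {n : ℕ} (f : ℝ → ℝ) (S : ℝ) :
    marketGradient f (S / n) S = symmetricGradient n f S := by
  unfold marketGradient symmetricGradient
  rcases eq_or_ne S 0 with rfl | hS
  · simp [average_zero]
  · field_simp

variable {f : ℝ → ℝ}

/-- A monotone derivative is continuous, since by Darboux's theorem it has no jumps. -/
lemma IsMarketPayoff.continuousOn_derivWithin (hf : IsMarketPayoff f) :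
    ContinuousOn (derivWithin f (Ici 0)) (Ici 0) := by
  have hanti := hf.concaveOn.antitoneOn_derivWithin hf.differentiableOn
  have hconn := ordConnected_Ici.image_derivWithin hf.differentiableOn
  set D := derivWithin f (Ici 0)
  intro a ha
  rw [ContinuousWithinAt, tendsto_order]
  constructor
  · intro b hb
    -- If there were no such `c`, `D` would jump at `a` over the values between `b` and `D a`.
    by_cases h : ∃ c, a < c ∧ b < D c
    · obtain ⟨c, hac, hbc⟩ := h
      filter_upwards [nhdsWithin_le_nhds (gt_mem_nhds hac), self_mem_nhdsWithin] with x hx hx0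
      exact hbc.trans_le (hanti hx0 (show (0 : ℝ) ≤ c from le_trans ha hac.le) hx.le)
    · push Not at h
      have ha1 : (0 : ℝ) ≤ a + 1 := by linarith [show (0 : ℝ) ≤ a from ha]
      obtain ⟨c, hc, hDc⟩ := hconn.out (mem_image_of_mem D (show a + 1 ∈ Ici (0 : ℝ) from ha1))
        (mem_image_of_mem D ha)
        (show (b + D a) / 2 ∈ _ from ⟨by linarith [h (a + 1) (by linarith)], by linarith⟩)
      have hac : a < c := by
        by_contra! hle
        linarith [hanti hc ha hle]
      linarith [h c hac]
  · intro b hb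
    by_cases h : ∃ c, 0 ≤ c ∧ c < a ∧ D c < b
    · obtain ⟨c, hc, hca, hcb⟩ := h
      filter_upwards [nhdsWithin_le_nhds (lt_mem_nhds hca), self_mem_nhdsWithin] with x hx hx0
      exact (hanti hc hx0 hx.le).trans_lt hcb
    · push Not at h
      rcases (show (0 : ℝ) ≤ a from ha).eq_or_lt with h0 | h0
      · filter_upwards [self_mem_nhdsWithin] with x hx
        exact (hanti ha hx (h0 ▸ hx)).trans_lt hb
      · obtain ⟨c, hc, hDc⟩ := hconn.out (mem_image_of_mem D ha)
          (mem_image_of_mem D (self_mem_Ici : (0 : ℝ) ∈ Ici 0))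
          (show (b + D a) / 2 ∈ _ from ⟨by linarith, by linarith [h 0 le_rfl h0]⟩)
        have hca : c < a := by
          by_contra! hle
          linarith [hanti ha hc hle]
        linarith [h c hc hca]

lemma IsMarketPayoff.continuousOn_average (hf : IsMarketPayoff f) :
    ContinuousOn (average f) (Ici 0) := by
  intro t ht
  rcases (show (0 : ℝ) ≤ t from ht).eq_or_lt with rfl | h0
  · have h1 : average f = Function.update (slope f 0) 0 (derivWithin f (Ici 0) 0) := by
      ext r
      rcases eq_or_ne r 0 with rfl | hr
      · simp [average_zero]
      · simp [average, hr, slope_def_field, hf.map_zero]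
    rw [h1, continuousWithinAt_update_same]
    exact hasDerivWithinAt_iff_tendsto_slope.1
      (hf.differentiableOn 0 self_mem_Ici).hasDerivWithinAt
  · have h1 : ContinuousWithinAt (fun r => f r / r) (Ici 0) t :=
      (hf.differentiableOn t ht).continuousWithinAt.div continuousWithinAt_id h0.ne'
    refine h1.congr_of_eventuallyEq ?_ (average_of_pos f h0)
    filter_upwards [nhdsWithin_le_nhds (lt_mem_nhds h0)] with r hr using average_of_pos f hr

lemma IsMarketPayoff.derivWithin_le_average (hf : IsMarketPayoff f) {t : ℝ} (ht : 0 ≤ t) :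
    derivWithin f (Ici 0) t ≤ average f t := by
  rcases ht.eq_or_lt with rfl | h0
  · rw [average_zero]
  · have := hf.concaveOn.derivWithin_le_slope (self_mem_Ici) (show t ∈ Ici 0 from ht) h0
      (hf.differentiableOn t ht)
    rwa [slope_def_field, hf.map_zero, sub_zero, sub_zero, ← average_of_pos f h0] at this

lemma IsMarketPayoff.antitoneOn_average (hf : IsMarketPayoff f) :
    AntitoneOn (average f) (Ici 0) := by
  intro s hs t ht hst
  rcases hst.eq_or_lt with rfl | hst
  · rfl
  rcases (show (0 : ℝ) ≤ s from hs).eq_or_lt with rfl | h0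
  · have := hf.concaveOn.slope_le_derivWithin hs ht hst (hf.differentiableOn 0 hs)
    rwa [slope_def_field, hf.map_zero, sub_zero, sub_zero, ← average_of_pos f hst,
      ← average_zero] at this
  · have ht0 : 0 < t := h0.trans hst
    have := hf.concaveOn.2 self_mem_Ici ht
      (show 0 ≤ 1 - s / t from sub_nonneg.2 ((div_le_one ht0).2 hst.le))
      (show 0 ≤ s / t by positivity) (by ring)
    rw [hf.map_zero, smul_zero, zero_add, zero_add, smul_eq_mul, smul_eq_mul,
      div_mul_cancel₀ _ ht0.ne'] at this
    rw [average_of_pos f h0, average_of_pos f ht0, le_div_iff₀ h0]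
    calc f t / t * s = s / t * f t := by ring
      _ ≤ f s := this

lemma IsMarketPayoff.strictAntiOn_div (hf : IsMarketPayoff f)
    (h : StrictConcaveOn ℝ (Ici 0) f) : StrictAntiOn (fun t => f t / t) (Ioi 0) := by
  intro s hs t ht hst
  have hs0 : 0 < s := hs
  have ht0 : 0 < t := ht
  have := h.2 self_mem_Ici ht0.le ht0.ne
    (show 0 < 1 - s / t from sub_pos.2 ((div_lt_one ht0).2 hst))
    (show 0 < s / t by positivity) (by ring)
  rw [hf.map_zero, smul_zero, zero_add, zero_add, smul_eq_mul, smul_eq_mul,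
    div_mul_cancel₀ _ ht0.ne'] at this
  rw [lt_div_iff₀ hs0]
  calc f t / t * s = s / t * f t := by ring
    _ < f s := this

/-- Concavity bounds `f' t` by the slope of `f` between `t / 2` and `t`, which is below
`f t / t` because the average payoff at `t / 2` is larger than at `t`. -/
lemma IsMarketPayoff.derivWithin_lt_average (hf : IsMarketPayoff f)
    (h : StrictAntiOn (fun t => f t / t) (Ioi 0)) {t : ℝ} (ht : 0 < t) :
    derivWithin f (Ici 0) t < average f t := by
  have h2 : (0 : ℝ) < t / 2 := by positivity
  have h1 := h (show t / 2 ∈ Ioi (0 : ℝ) from h2) (show t ∈ Ioi (0 : ℝ) from ht) (by linarith)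
  have h3 := hf.concaveOn.derivWithin_le_slope (show t / 2 ∈ Ici (0 : ℝ) from h2.le)
    (show t ∈ Ici (0 : ℝ) from ht.le) (by linarith) (hf.differentiableOn t ht.le)
  rw [average_of_pos f ht]
  refine h3.trans_lt ?_
  simp only at h1
  rw [div_lt_div_iff₀ ht h2] at h1
  rw [slope_def_field, div_lt_div_iff₀ (by linarith) ht]
  nlinarith

lemma IsMarketPayoff.strictAntiOn_average (hf : IsMarketPayoff f)
    (h : StrictAntiOn (fun t => f t / t) (Ioi 0)) : StrictAntiOn (average f) (Ici 0) := by
  have hpos : ∀ s t : ℝ, 0 < s → s < t → average f t < average f s := fun s t hs hst => by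
    rw [average_of_pos f hs, average_of_pos f (hs.trans hst)]
    exact h hs (hs.trans hst) hst
  intro s hs t ht hst
  rcases (show (0 : ℝ) ≤ s from hs).eq_or_lt with rfl | h0
  · exact (hpos (t / 2) t (by linarith) (by linarith)).trans_le
      (hf.antitoneOn_average hs (show (0 : ℝ) ≤ t / 2 by linarith) (by linarith))
  · exact hpos s t h0 hst

lemma IsMarketPayoff.continuousOn_symmetricGradient (hf : IsMarketPayoff f) (n : ℕ) :
    ContinuousOn (symmetricGradient n f) (Ici 0) :=
  hf.continuousOn_average.add
    ((hf.continuousOn_derivWithin.sub hf.continuousOn_average).div_const _)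

lemma IsMarketPayoff.strictAntiOn_symmetricGradient (hf : IsMarketPayoff f) {n : ℕ} (hn : 1 ≤ n)
    (h : StrictConcaveOn ℝ (Ici 0) f ∨ (2 ≤ n ∧ StrictAntiOn (fun t => f t / t) (Ioi 0))) :
    StrictAntiOn (symmetricGradient n f) (Ici 0) := by
  have hn0 : (0 : ℝ) < n := by exact_mod_cast hn
  have e : ∀ S, symmetricGradient n f S =
      (1 - 1 / n) * average f S + 1 / n * derivWithin f (Ici 0) S := fun S => by
    unfold symmetricGradient
    ring
  intro s hs t ht hst
  rw [e, e]
  rcases h with h | ⟨h2, h⟩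
  · have h1 := hf.antitoneOn_average hs ht hst.le
    have h2 := h.strictAntiOn_derivWithin hf.differentiableOn hs ht hst
    have h3 : (1 : ℝ) / n ≤ 1 := (div_le_one hn0).2 (by exact_mod_cast hn)
    exact add_lt_add_of_le_of_lt (mul_le_mul_of_nonneg_left h1 (by linarith))
      (mul_lt_mul_of_pos_left h2 (by positivity))
  · have h1 := hf.strictAntiOn_average h hs ht hst
    have h2' := hf.concaveOn.antitoneOn_derivWithin hf.differentiableOn hs ht hst.le
    have h3 : (1 : ℝ) / n < 1 := (div_lt_one hn0).2 (by exact_mod_cast h2)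
    exact add_lt_add_of_lt_of_le (mul_lt_mul_of_pos_left h1 (by linarith))
      (mul_le_mul_of_nonneg_left h2' (by positivity))

lemma IsMarketPayoff.continuousOn_marketGradient (hf : IsMarketPayoff f) :
    ContinuousOn (fun q : ℝ × ℝ => marketGradient f q.1 q.2) {q | 0 ≤ q.1 ∧ q.1 ≤ q.2} := by
  have hmap : MapsTo (Prod.snd : ℝ × ℝ → ℝ) {q | 0 ≤ q.1 ∧ q.1 ≤ q.2} (Ici 0) :=
    fun q hq => hq.1.trans hq.2
  have h1 := hf.continuousOn_average.comp continuousOn_snd hmap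
  have h2 := hf.continuousOn_derivWithin.comp continuousOn_snd hmap
  refine h1.add fun q hq => ?_
  rcases (show 0 ≤ q.2 from hmap hq).eq_or_lt with h0 | h0
  · have h3 := (h2.sub h1) q hq
    have hzero : derivWithin f (Ici 0) q.2 - average f q.2 = 0 := by
      rw [← h0, average_zero, sub_self]
    rw [ContinuousWithinAt] at h3 ⊢
    simp only [Pi.sub_apply, Function.comp, hzero, zero_mul] at h3 ⊢
    -- The shares `a / S` are bounded by `1`.
    refine squeeze_zero_norm' ?_ (by simpa using h3.norm)
    filter_upwards [self_mem_nhdsWithin] with r hr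
    rw [norm_mul]
    refine mul_le_of_le_one_right (norm_nonneg _) ?_
    rw [Real.norm_of_nonneg (div_nonneg hr.1 (hr.1.trans hr.2))]
    exact div_le_one_of_le₀ hr.2 (hr.1.trans hr.2)
  · exact ((h2.sub h1) q hq).mul
      (continuousWithinAt_fst.div continuousWithinAt_snd h0.ne')

/-- For `a = c = 0` the function is `f` itself: `f t / t * t = f t` holds at `t = 0` too, because
`f 0 = 0`. -/
lemma IsMarketPayoff.hasDerivWithinAt_payoff (hf : IsMarketPayoff f) {a c : ℝ} (ha : 0 ≤ a)
    (hc : 0 ≤ c) :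
    HasDerivWithinAt (fun t => f (t + c) / (t + c) * t) (marketGradient f a (a + c)) (Ici 0) a := by
  rcases (add_nonneg ha hc).eq_or_lt with h0 | h0
  · obtain rfl : a = 0 := by linarith
    obtain rfl : c = 0 := by linarith
    have h1 : (fun t => f (t + 0) / (t + 0) * t) = f := by
      ext t
      rcases eq_or_ne t 0 with rfl | ht
      · simp [hf.map_zero]
      · simp [ht]
    rw [h1]
    simpa [marketGradient, average_zero] using
      (hf.differentiableOn 0 self_mem_Ici).hasDerivWithinAt
  · have h1 : HasDerivWithinAt (fun t => t + c) 1 (Ici 0) a :=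
      (hasDerivWithinAt_id a _).add_const c
    have h2 : HasDerivWithinAt (fun t => f (t + c)) (derivWithin f (Ici 0) (a + c) * 1) (Ici 0) a :=
      HasDerivWithinAt.comp a (hf.differentiableOn (a + c) h0.le).hasDerivWithinAt h1
        fun t ht => add_nonneg (show (0 : ℝ) ≤ t from ht) hc
    refine ((h2.div h1 h0.ne').mul (hasDerivWithinAt_id a _)).congr_deriv ?_
    simp only [marketGradient, average_of_pos f h0, Pi.div_apply, id]
    field_simp
    ring

/-- A firm's payoff in a single market is concave in its own investment: it lies below its
tangents. -/
lemma IsMarketPayoff.payoff_le (hf : IsMarketPayoff f) {a b c : ℝ} (ha : 0 ≤ a) (hb : 0 ≤ b)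
    (hc : 0 ≤ c) :
    f (b + c) / (b + c) * b ≤ f (a + c) / (a + c) * a + marketGradient f a (a + c) * (b - a) := by
  have htan : ∀ S T : ℝ, 0 ≤ S → 0 ≤ T → f T ≤ f S + derivWithin f (Ici 0) S * (T - S) := by
    intro S T hS hT
    rcases lt_trichotomy S T with h | rfl | h
    · have := hf.concaveOn.slope_le_derivWithin hS hT h (hf.differentiableOn S hS)
      rw [slope_def_field, div_le_iff₀ (by linarith)] at this
      linarith
    · simp
    · have := hf.concaveOn.derivWithin_le_slope hT hS h (hf.differentiableOn S hS)
      rw [slope_def_field, le_div_iff₀ (by linarith)] at this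
      linarith
  rcases (add_nonneg ha hc).eq_or_lt with h0 | h0
  · obtain rfl : a = 0 := by linarith
    obtain rfl : c = 0 := by linarith
    have h1 := htan 0 b le_rfl hb
    rw [hf.map_zero] at h1
    rcases hb.eq_or_lt with rfl | hb
    · simp
    · simpa [marketGradient, average_zero, hb.ne'] using h1
  have hmp := hf.derivWithin_le_average h0.le
  unfold marketGradient
  rcases (add_nonneg hb hc).eq_or_lt with h1 | h1
  · obtain rfl : b = 0 := by linarith
    obtain rfl : c = 0 := by linarith
    simp only [add_zero] at h0 hmp ⊢
    rw [div_self h0.ne', ← average_of_pos f h0]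
    nlinarith
  · have h2 := htan (a + c) (b + c) h0.le h1.le
    have hfS : f (a + c) = average f (a + c) * (a + c) := by
      rw [average_of_pos f h0, div_mul_cancel₀ _ h0.ne']
    rw [hfS] at h2 ⊢
    set m := derivWithin f (Ici 0) (a + c)
    set p := average f (a + c)
    rw [mul_div_assoc, div_self h0.ne', mul_one]
    calc f (b + c) / (b + c) * b ≤ (p * (a + c) + m * (b + c - (a + c))) / (b + c) * b := by gcongr
      _ = p * a + (p + (m - p) * (a / (a + c))) * (b - a)
          - (p - m) * (c * (b - a) ^ 2 / ((a + c) * (b + c))) := by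
        field_simp
        ring
      _ ≤ _ := by
        have : 0 ≤ (p - m) * (c * (b - a) ^ 2 / ((a + c) * (b + c))) :=
          mul_nonneg (by linarith) (by positivity)
        linarith

end Market

/-! ### Strategies and gradients -/

section Strategies

variable {N E : Type*}

lemma nonneg_of_mem_strategySpace [Fintype E] {v : EuclideanSpace ℝ E}
    (hv : v ∈ strategySpace E) (x : E) :
    0 ≤ v x := hv.1 x

lemma convex_strategySpace [Fintype E] : Convex ℝ (strategySpace E) :=
  fun _ hv _ hw _ _ ha hb hab => convex_stdSimplex ℝ E hv hw ha hb hab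

lemma isCompact_strategySpace [Fintype E] : IsCompact (strategySpace E) :=
  (EuclideanSpace.equiv E ℝ).toHomeomorph.isCompact_preimage.2 (isCompact_stdSimplex ℝ E)

lemma strategySpace_nonempty [Fintype E] [DecidableEq E] [Nonempty E] :
    (strategySpace E).Nonempty :=
  ⟨WithLp.toLp 2 (Pi.single (Classical.arbitrary E) 1), single_mem_stdSimplex ℝ _⟩

lemma profiles_eq_pi [Fintype E] : profiles N E = Set.pi univ fun _ : N => strategySpace E := by
  ext s
  simp [profiles]

lemma isCompact_profiles [Fintype N] [Fintype E] : IsCompact (profiles N E) := by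
  rw [profiles_eq_pi]
  exact isCompact_univ_pi fun _ => isCompact_strategySpace

lemma le_sum_of_mem_profiles [Fintype N] [Fintype E] {s : N → EuclideanSpace ℝ E}
    (hs : s ∈ profiles N E) (i : N) (x : E) :
    s i x ≤ ∑ j, s j x :=
  Finset.single_le_sum (f := fun j => s j x) (fun j _ => nonneg_of_mem_strategySpace (hs j) x)
    (Finset.mem_univ i)

lemma sum_nonneg_of_mem_profiles [Fintype N] [Fintype E] {s : N → EuclideanSpace ℝ E}
    (hs : s ∈ profiles N E) (x : E) :
    0 ≤ ∑ j, s j x :=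
  Finset.sum_nonneg fun j _ => nonneg_of_mem_strategySpace (hs j) x

lemma add_opponents [Fintype N] [DecidableEq N] (s : N → EuclideanSpace ℝ E) (i : N) (x : E) :
    s i x + opponents s i x = ∑ j, s j x :=
  Finset.add_sum_erase Finset.univ (fun j => s j x) (Finset.mem_univ i)

lemma opponents_nonneg [Fintype N] [DecidableEq N] [Fintype E] {s : N → EuclideanSpace ℝ E}
    (hs : s ∈ profiles N E) (i : N) (x : E) : 0 ≤ opponents s i x :=
  Finset.sum_nonneg fun j _ => nonneg_of_mem_strategySpace (hs j) x

lemma euclidean_inner [Fintype E] (v w : EuclideanSpace ℝ E) : ⟪v, w⟫ = ∑ x, v x * w x := by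
  simp [PiLp.inner_apply, mul_comm]

end Strategies

section Gradient

variable {N E : Type*} [Fintype N] {u : E → ℝ → ℝ}

/-- The gradient of firm `i`'s payoff in its own strategy, in terms of its own and of the total
investments. -/
noncomputable def profileGradient (u : E → ℝ → ℝ) (s : N → EuclideanSpace ℝ E) (i : N) :
    EuclideanSpace ℝ E :=
  WithLp.toLp 2 fun x => marketGradient (u x) (s i x) (∑ j, s j x)

lemma payoffGradient_eq [DecidableEq N] [Fintype E] [DecidableEq E]
    (hu : ∀ x, IsMarketPayoff (u x)) {s : N → EuclideanSpace ℝ E} (hs : s ∈ profiles N E) (i : N) :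
    payoffGradient u (fun x => s i x) (opponents s i) = profileGradient u s i := by
  ext x
  simp only [payoffGradient, profileGradient]
  refine HasDerivWithinAt.derivWithin ?_
    (uniqueDiffOn_Ici (0 : ℝ) _ (nonneg_of_mem_strategySpace (hs i) x))
  have hterm : ∀ y ∈ (Finset.univ : Finset E), HasDerivWithinAt
      (fun t => u y (Function.update (fun x => s i x) x t y + opponents s i y) /
        (Function.update (fun x => s i x) x t y + opponents s i y) *
          Function.update (fun x => s i x) x t y)
      (if y = x then marketGradient (u x) (s i x) (∑ j, s j x) else 0) (Ici 0) (s i x) := by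
    intro y _
    rcases eq_or_ne y x with rfl | hyx
    · rw [if_pos rfl, ← add_opponents s i]
      simpa using (hu y).hasDerivWithinAt_payoff (nonneg_of_mem_strategySpace (hs i) y)
        (opponents_nonneg hs i y)
    · simp only [if_neg hyx, Function.update_of_ne hyx]
      exact hasDerivWithinAt_const _ _ _
  simpa [payoff] using HasDerivWithinAt.fun_sum hterm

lemma continuousOn_profileGradient [Fintype E] (hu : ∀ x, IsMarketPayoff (u x)) (i : N) :
    ContinuousOn (fun s => profileGradient u s i) (profiles N E) := by
  refine (PiLp.continuous_toLp 2 _).comp_continuousOn (continuousOn_pi.2 fun x => ?_)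
  refine (hu x).continuousOn_marketGradient.comp
    (f := fun s : N → EuclideanSpace ℝ E => (s i x, ∑ j, s j x)) ?_ fun s hs =>
      ⟨nonneg_of_mem_strategySpace (hs i) x, le_sum_of_mem_profiles hs i x⟩
  exact Continuous.continuousOn (by fun_prop)

/-- The gradients of two firms differ by a negative multiple of the difference of their investments
in each market. -/
lemma inner_profileGradient_sub_neg [Fintype E] (hu : ∀ x, IsMarketPayoff (u x))
    (hstrict : ∀ x, StrictAntiOn (fun t => u x t / t) (Ioi 0)) {s : N → EuclideanSpace ℝ E}
    (hs : s ∈ profiles N E) {i j : N} (hij : s i ≠ s j) :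
    ⟪profileGradient u s i - profileGradient u s j, s i - s j⟫ < 0 := by
  rw [euclidean_inner]
  have hterm : ∀ x, (profileGradient u s i - profileGradient u s j) x * (s i - s j) x =
      (derivWithin (u x) (Ici 0) (∑ k, s k x) - average (u x) (∑ k, s k x)) *
        ((s i x - s j x) ^ 2 / ∑ k, s k x) := by
    intro x
    simp only [profileGradient, marketGradient, PiLp.sub_apply]
    ring
  simp only [hterm]
  obtain ⟨x, hx⟩ : ∃ x, s i x ≠ s j x := by
    by_contra! h
    exact hij (PiLp.ext h)
  have hle : ∀ x, (derivWithin (u x) (Ici 0) (∑ k, s k x) - average (u x) (∑ k, s k x)) *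
      ((s i x - s j x) ^ 2 / ∑ k, s k x) ≤ 0 := fun x =>
    mul_nonpos_of_nonpos_of_nonneg
      (sub_nonpos.2 ((hu x).derivWithin_le_average (sum_nonneg_of_mem_profiles hs x)))
      (div_nonneg (sq_nonneg _) (sum_nonneg_of_mem_profiles hs x))
  refine Finset.sum_neg' (fun x _ => hle x) ⟨x, Finset.mem_univ x, ?_⟩
  have hpos : 0 < ∑ k, s k x := by
    refine (sum_nonneg_of_mem_profiles hs x).lt_of_ne fun h0 => hx ?_
    have h1 := le_sum_of_mem_profiles hs i x
    have h2 := le_sum_of_mem_profiles hs j x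
    have h3 := nonneg_of_mem_strategySpace (hs i) x
    have h4 := nonneg_of_mem_strategySpace (hs j) x
    linarith
  exact mul_neg_of_neg_of_pos (sub_neg.2 ((hu x).derivWithin_lt_average (hstrict x) hpos))
    (div_pos (by have := sub_ne_zero.2 hx; positivity) hpos)

lemma profileGradient_const (v : EuclideanSpace ℝ E) (i : N) (x : E) :
    profileGradient u (fun _ : N => v) i x =
      symmetricGradient (Fintype.card N) (u x) (Fintype.card N * v x) := by
  have hn : (Fintype.card N : ℝ) ≠ 0 := by
    have : Nonempty N := ⟨i⟩
    exact_mod_cast Fintype.card_ne_zero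
  rw [← marketGradient_div, mul_div_cancel_left₀ _ hn]
  simp [profileGradient]

end Gradient

/-! ### Equilibrium and trajectories -/

section Equilibrium

variable {N E : Type*} {u : E → ℝ → ℝ}

lemma deriv_nonpos_of_max {φ : ℝ → ℝ} {d : ℝ} (hφ : HasDerivWithinAt φ d (Icc 0 1) 0)
    (hmax : ∀ θ ∈ Icc (0 : ℝ) 1, φ θ ≤ φ 0) : d ≤ 0 := by
  have h1 : (1 : ℝ) ∈ posTangentConeAt (Icc (0 : ℝ) 1) 0 := by
    have := sub_mem_posTangentConeAt_of_segment_subset (s := Icc (0 : ℝ) 1) (x := 0) (y := 1)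
      (by rw [segment_eq_Icc zero_le_one])
    simpa using this
  have h2 : IsLocalMaxOn φ (Icc 0 1) 0 := by
    filter_upwards [self_mem_nhdsWithin] with θ hθ using hmax θ hθ
  simpa using h2.hasFDerivWithinAt_nonpos hφ.hasFDerivWithinAt h1

/-- Nash equilibria are characterized by the first-order conditions, since payoffs are concave in a
firm's own strategy. -/
lemma isNashEquilibrium_iff [Fintype N] [DecidableEq N] [Fintype E]
    (hu : ∀ x, IsMarketPayoff (u x)) (s : N → EuclideanSpace ℝ E) :
    IsNashEquilibrium u s ↔ s ∈ profiles N E ∧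
      ∀ i, ∀ v ∈ strategySpace E, ⟪profileGradient u s i, v - s i⟫ ≤ 0 := by
  refine and_congr_right fun hs => forall_congr' fun i => ⟨fun h v hv => ?_, fun h v hv => ?_⟩
  · have hnn : ∀ x, ∀ θ ∈ Icc (0 : ℝ) 1, 0 ≤ s i x + θ * (v x - s i x) := by
      intro x θ hθ
      have h1 := mul_nonneg (sub_nonneg.2 hθ.2) (nonneg_of_mem_strategySpace (hs i) x)
      have h2 := mul_nonneg hθ.1 (nonneg_of_mem_strategySpace hv x)
      linarith
    have hterm : ∀ x ∈ (Finset.univ : Finset E), HasDerivWithinAt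
        (fun θ : ℝ => u x (s i x + θ * (v x - s i x) + opponents s i x) /
          (s i x + θ * (v x - s i x) + opponents s i x) * (s i x + θ * (v x - s i x)))
        (profileGradient u s i x * (v x - s i x)) (Icc 0 1) 0 := by
      intro x _
      have h1 : HasDerivWithinAt (fun θ : ℝ => s i x + θ * (v x - s i x)) (v x - s i x)
          (Icc 0 1) 0 := by
        simpa using ((hasDerivWithinAt_id (0 : ℝ) (Icc 0 1)).mul_const (v x - s i x)).const_add
          (s i x)
      have h2 := (hu x).hasDerivWithinAt_payoff (nonneg_of_mem_strategySpace (hs i) x)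
        (opponents_nonneg hs i x)
      rw [add_opponents] at h2
      refine HasDerivWithinAt.comp (h := fun θ : ℝ => s i x + θ * (v x - s i x))
        (h₂ := fun t => u x (t + opponents s i x) / (t + opponents s i x) * t) (0 : ℝ)
        (s' := Ici 0) ?_ h1 fun θ hθ => hnn x θ hθ
      simpa [profileGradient] using h2
    rw [euclidean_inner]
    refine deriv_nonpos_of_max (HasDerivWithinAt.fun_sum hterm) fun θ hθ => ?_
    have hmem : s i + θ • (v - s i) ∈ strategySpace E :=
      convex_strategySpace.add_smul_sub_mem (hs i) hv hθ
    simpa [payoff] using h _ hmem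
  · have h1 := h v hv
    rw [euclidean_inner] at h1
    have h2 : payoff u (fun x => v x) (opponents s i) ≤
        payoff u (fun x => s i x) (opponents s i) +
          ∑ x, profileGradient u s i x * (v - s i) x := by
      rw [payoff, payoff, ← Finset.sum_add_distrib]
      refine Finset.sum_le_sum fun x _ => ?_
      have := (hu x).payoff_le (nonneg_of_mem_strategySpace (hs i) x)
        (nonneg_of_mem_strategySpace hv x) (opponents_nonneg hs i x)
      rw [add_opponents] at this ⊢
      exact this
    linarith

/-- The first-order conditions of a separable maximization problem over the simplex: the solution
maximizes the sum of antiderivatives of the functions `h x (c * ·)`. -/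
lemma exists_variational_solution [Fintype E] [DecidableEq E] [Nonempty E] {h : E → ℝ → ℝ}
    (hh : ∀ x, ContinuousOn (h x) (Ici 0)) {c : ℝ} (hc : 0 ≤ c) :
    ∃ σ ∈ strategySpace E, ∀ v ∈ strategySpace E, ∑ x, h x (c * σ x) * (v x - σ x) ≤ 0 := by
  have hcont : ∀ x, Continuous fun τ : ℝ => h x (c * max τ 0) := fun x =>
    (hh x).comp_continuous (by fun_prop) fun τ => mul_nonneg hc (le_max_right _ _)
  set H : E → ℝ → ℝ := fun x t => ∫ τ in (0 : ℝ)..t, h x (c * max τ 0)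
  have hder : ∀ x t, HasDerivAt (H x) (h x (c * max t 0)) t := fun x t =>
    intervalIntegral.integral_hasDerivAt_right ((hcont x).intervalIntegrable _ _)
      ((hcont x).stronglyMeasurableAtFilter _ _) (hcont x).continuousAt
  have hHc : ∀ x, Continuous (H x) := fun x =>
    continuous_iff_continuousAt.2 fun t => (hder x t).continuousAt
  obtain ⟨σ, hσ, hmax⟩ := (isCompact_strategySpace (E := E)).exists_isMaxOn strategySpace_nonempty
    (f := fun v => ∑ x, H x (v x)) (Continuous.continuousOn (by fun_prop))
  refine ⟨σ, hσ, fun v hv => ?_⟩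
  have hterm : ∀ x ∈ (Finset.univ : Finset E), HasDerivWithinAt
      (fun θ : ℝ => H x (σ x + θ * (v x - σ x))) (h x (c * σ x) * (v x - σ x)) (Icc 0 1) 0 := by
    intro x _
    have h1 : HasDerivAt (fun θ : ℝ => σ x + θ * (v x - σ x)) (v x - σ x) 0 := by
      simpa using ((hasDerivAt_id (0 : ℝ)).mul_const (v x - σ x)).const_add (σ x)
    have h2 := hder x (σ x)
    rw [max_eq_left (nonneg_of_mem_strategySpace hσ x)] at h2
    refine (HasDerivAt.comp (h₂ := H x) (h₂' := h x (c * σ x))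
      (h := fun θ : ℝ => σ x + θ * (v x - σ x)) (0 : ℝ) ?_ h1).hasDerivWithinAt
    simpa using h2
  refine deriv_nonpos_of_max (HasDerivWithinAt.fun_sum hterm) fun θ hθ => ?_
  have hmem : σ + θ • (v - σ) ∈ strategySpace E :=
    convex_strategySpace.add_smul_sub_mem hσ hv hθ
  simpa using hmax hmem

/-- On symmetric profiles the gradient field is strictly monotone. -/
lemma inner_profileGradient_const_neg [Fintype N] [Fintype E]
    (hanti : ∀ x, StrictAntiOn (symmetricGradient (Fintype.card N) (u x)) (Ici 0))
    {σ v : EuclideanSpace ℝ E} (hσ : σ ∈ strategySpace E) (hv : v ∈ strategySpace E) (hne : v ≠ σ)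
    (i : N) (hvi : ⟪profileGradient u (fun _ : N => σ) i, v - σ⟫ ≤ 0) :
    ⟪profileGradient u (fun _ : N => v) i, v - σ⟫ < 0 := by
  refine lt_of_lt_of_le ?_ hvi
  have hn : (0 : ℝ) < Fintype.card N := by
    have : Nonempty N := ⟨i⟩
    exact_mod_cast Fintype.card_pos
  rw [euclidean_inner, euclidean_inner]
  simp only [profileGradient_const, PiLp.sub_apply]
  have hlt : ∀ x, v x ≠ σ x →
      symmetricGradient (Fintype.card N) (u x) (Fintype.card N * v x) * (v x - σ x) <
        symmetricGradient (Fintype.card N) (u x) (Fintype.card N * σ x) * (v x - σ x) := by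
    intro x hx
    have hv0 : (0 : ℝ) ≤ Fintype.card N * v x :=
      mul_nonneg hn.le (nonneg_of_mem_strategySpace hv x)
    have hσ0 : (0 : ℝ) ≤ Fintype.card N * σ x :=
      mul_nonneg hn.le (nonneg_of_mem_strategySpace hσ x)
    rcases hx.lt_or_gt with h | h
    · exact mul_lt_mul_of_neg_right (hanti x hv0 hσ0 (by gcongr)) (sub_neg.2 h)
    · exact mul_lt_mul_of_pos_right (hanti x hσ0 hv0 (by gcongr)) (sub_pos.2 h)
  obtain ⟨x, hx⟩ : ∃ x, v x ≠ σ x := by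
    by_contra! h
    exact hne (PiLp.ext h)
  refine Finset.sum_lt_sum (fun y _ => ?_) ⟨x, Finset.mem_univ x, hlt x hx⟩
  by_cases hy : v y = σ y
  · simp [hy]
  · exact (hlt y hy).le

end Equilibrium

section Trajectories

variable {N E : Type*} [Fintype N] [DecidableEq N] [Fintype E] [DecidableEq E] {u : E → ℝ → ℝ}

lemma exists_isTrajectory (hu : ∀ x, IsMarketPayoff (u x)) {s₀ : N → EuclideanSpace ℝ E}
    (hs₀ : s₀ ∈ profiles N E) : ∃ s, IsTrajectory u s ∧ s 0 = s₀ := by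
  have hcont := fun i : N => continuousOn_profileGradient hu i
  rw [profiles_eq_pi] at hs₀
  simp only [profiles_eq_pi] at hcont
  obtain ⟨s, hs0, hs, ⟨M, hM⟩, hproj⟩ := exists_projected_solution isCompact_strategySpace
    convex_strategySpace (G := fun i s => profileGradient u s i) hcont hs₀
  rw [← profiles_eq_pi] at hs
  refine ⟨s, ⟨fun t _ => hs t, fun i b _ => ?_, ?_⟩, hs0⟩
  · exact (hM i).lipschitzOnWith.absolutelyContinuousOnInterval
  · filter_upwards [ae_all_iff.2 fun i => (hM i).ae_differentiableAt_real] with t ht ht0 i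
    refine ⟨_, ?_, (ht i).hasDerivAt⟩
    rw [payoffGradient_eq hu (hs t)]
    exact hproj t ht0.le i _ (ht i).hasDerivAt

variable {s : ℝ → N → EuclideanSpace ℝ E}

/-- Replacing the projected gradient by the gradient overestimates the velocity away from any
strategy `y`. -/
lemma IsTrajectory.velocity (h : IsTrajectory u s) (hu : ∀ x, IsMarketPayoff (u x)) :
    ∀ᵐ t : ℝ, 0 < t → ∃ v : N → EuclideanSpace ℝ E, ∀ i, HasDerivAt (fun τ => s τ i) (v i) t ∧
      ∀ y ∈ strategySpace E, ⟪v i, s t i - y⟫ ≤ ⟪profileGradient u (s t) i, s t i - y⟫ := by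
  filter_upwards [h.equation] with t ht ht0
  have hmem := h.mem_profiles t ht0.le
  choose v hv hder using ht ht0
  refine ⟨v, fun i => ⟨hder i, fun y hy => ?_⟩⟩
  have h1 := (hv i).inner_le_zero convex_strategySpace (hmem i) hy
  rw [payoffGradient_eq hu hmem, ← neg_sub (s t i) y, inner_neg_right, inner_sub_left] at h1
  linarith

lemma IsTrajectory.derivAtMost_pairs (h : IsTrajectory u s) (hu : ∀ x, IsMarketPayoff (u x)) :
    DerivAtMost (fun t => ∑ i, ∑ j, ‖s t i - s t j‖ ^ 2) fun t => ∑ i, ∑ j,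
      2 * ⟪profileGradient u (s t) i - profileGradient u (s t) j, s t i - s t j⟫ := by
  refine ⟨fun b hb => absolutelyContinuousOnInterval_sum fun i _ =>
    absolutelyContinuousOnInterval_sum fun j _ => absolutelyContinuousOnInterval_norm_sq
      ((h.absolutelyContinuous i b hb).fun_sub (h.absolutelyContinuous j b hb)), ?_⟩
  filter_upwards [h.velocity hu] with t ht ht0
  obtain ⟨v, hv⟩ := ht ht0
  have hmem := h.mem_profiles t ht0.le
  refine ⟨_, ?_, HasDerivAt.fun_sum fun i _ => HasDerivAt.fun_sum fun j _ =>
    ((hv i).1.fun_sub (hv j).1).norm_sq⟩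
  refine Finset.sum_le_sum fun i _ => Finset.sum_le_sum fun j _ => ?_
  have h1 := (hv i).2 _ (hmem j)
  have h2 := (hv j).2 _ (hmem i)
  rw [← neg_sub, inner_neg_right, inner_neg_right] at h2
  rw [real_inner_comm, inner_sub_left, inner_sub_left]
  linarith

lemma IsTrajectory.derivAtMost_dist (h : IsTrajectory u s) (hu : ∀ x, IsMarketPayoff (u x))
    {p : N → EuclideanSpace ℝ E} (hp : p ∈ profiles N E) :
    DerivAtMost (fun t => ∑ i, ‖s t i - p i‖ ^ 2) fun t => ∑ i,
      2 * ⟪profileGradient u (s t) i, s t i - p i⟫ := by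
  refine ⟨fun b hb => absolutelyContinuousOnInterval_sum fun i _ =>
    absolutelyContinuousOnInterval_norm_sq ((h.absolutelyContinuous i b hb).fun_sub
      (LipschitzWith.const (p i)).lipschitzOnWith.absolutelyContinuousOnInterval), ?_⟩
  filter_upwards [h.velocity hu] with t ht ht0
  obtain ⟨v, hv⟩ := ht ht0
  refine ⟨_, ?_, HasDerivAt.fun_sum fun i _ => ((hv i).1.sub_const (p i)).norm_sq⟩
  refine Finset.sum_le_sum fun i _ => ?_
  have h1 := (hv i).2 _ (hp i)
  rw [real_inner_comm]
  linarith

end Trajectories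

end MultiMarket

theorem proposition7 {N E : Type*} [Fintype N] [DecidableEq N] [Nonempty N]
    [Fintype E] [DecidableEq E] [Nonempty E] (u : E → ℝ → ℝ)
    (hu : ∀ x, MultiMarket.IsMarketPayoff (u x))
    (hstrict : ∀ x, StrictConcaveOn ℝ (Set.Ici 0) (u x) ∨
      (2 ≤ Fintype.card N ∧ StrictAntiOn (fun t => u x t / t) (Set.Ioi 0))) :
    (∀ s₀ ∈ MultiMarket.profiles N E, ∃ s : ℝ → N → EuclideanSpace ℝ E,
      MultiMarket.IsTrajectory u s ∧ s 0 = s₀) ∧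
    ∃ p : N → EuclideanSpace ℝ E,
      MultiMarket.IsNashEquilibrium u p ∧
      (∀ q : N → EuclideanSpace ℝ E, MultiMarket.IsNashEquilibrium u q → q = p) ∧
      MultiMarket.IsGloballyAsymptoticallyStable
        {s : ℝ → N → EuclideanSpace ℝ E | MultiMarket.IsTrajectory u s} p := by
  open MultiMarket RealInnerProductSpace in
  refine ⟨fun s₀ hs₀ => exists_isTrajectory hu hs₀, ?_⟩
  have hdiv : ∀ x, StrictAntiOn (fun t => u x t / t) (Set.Ioi 0) := fun x =>
    (hstrict x).elim (hu x).strictAntiOn_div And.right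
  have hanti : ∀ x, StrictAntiOn (symmetricGradient (Fintype.card N) (u x)) (Set.Ici 0) := fun x =>
    (hu x).strictAntiOn_symmetricGradient Fintype.card_pos (hstrict x)
  obtain ⟨σ, hσ, hvar⟩ := exists_variational_solution
    (h := fun x => symmetricGradient (Fintype.card N) (u x))
    (fun x => (hu x).continuousOn_symmetricGradient _) (c := Fintype.card N) (Nat.cast_nonneg _)
  have hp : (fun _ : N => σ) ∈ profiles N E := fun _ => hσ
  have hfoc : ∀ i : N, ∀ v ∈ strategySpace E,
      ⟪profileGradient u (fun _ : N => σ) i, v - σ⟫ ≤ 0 := by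
    intro i v hv
    rw [euclidean_inner]
    simpa only [profileGradient_const, PiLp.sub_apply] using hvar v hv
  have hW : ∀ s ∈ profiles N E, (∀ i j, s i = s j) → s ≠ (fun _ => σ) → ∀ i,
      ⟪profileGradient u s i, s i - σ⟫ < 0 := by
    intro s hs hsym hne i
    have hsi : s = fun _ => s i := funext fun j => hsym j i
    have hsσ : s i ≠ σ := fun h => hne (by rw [hsi, h])
    have := inner_profileGradient_const_neg hanti hσ (hs i) hsσ i (hfoc i _ (hs i))
    rwa [← hsi] at this
  refine ⟨fun _ => σ, (isNashEquilibrium_iff hu _).2 ⟨hp, hfoc⟩, fun q hq => ?_, ?_⟩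
  · obtain ⟨hqmem, hqvar⟩ := (isNashEquilibrium_iff hu q).1 hq
    have hsym : ∀ i j, q i = q j := by
      intro i j
      by_contra hij
      have h1 := inner_profileGradient_sub_neg hu hdiv hqmem hij
      have h2 := hqvar i _ (hqmem j)
      have h3 := hqvar j _ (hqmem i)
      rw [← neg_sub, inner_neg_right] at h2
      rw [inner_sub_left] at h1
      linarith
    by_contra hne
    obtain ⟨i⟩ := ‹Nonempty N›
    have h1 := hW q hqmem hsym hne i
    have h2 := hqvar i σ hσ
    rw [← neg_sub, inner_neg_right] at h2
    linarith
  · have hg := fun i : N => continuousOn_profileGradient hu i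
    have hpair : ∀ s : N → EuclideanSpace ℝ E, (∑ i, ∑ j, ‖s i - s j‖ ^ 2 = 0) →
        ∀ i j, s i = s j := by
      intro s hs i j
      have h1 := (Finset.sum_eq_zero_iff_of_nonneg
        (fun i _ => Finset.sum_nonneg fun j _ => sq_nonneg ‖s i - s j‖)).1 hs i (Finset.mem_univ i)
      have h2 := (Finset.sum_eq_zero_iff_of_nonneg
        (fun j _ => sq_nonneg ‖s i - s j‖)).1 h1 j (Finset.mem_univ j)
      simpa [sub_eq_zero] using h2
    refine isGloballyAsymptoticallyStable_of_cascade isCompact_profiles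
      (V₁ := fun s => ∑ i, ∑ j, ‖s i - s j‖ ^ 2) (V₂ := fun s => ∑ i, ‖s i - σ‖ ^ 2)
      (W₁ := fun s => ∑ i, ∑ j,
        2 * ⟪profileGradient u s i - profileGradient u s j, s i - s j⟫)
      (W₂ := fun s => ∑ i, 2 * ⟪profileGradient u s i, s i - σ⟫)
      (Continuous.continuousOn (by fun_prop)) (Continuous.continuousOn (by fun_prop))
      ?_ ?_ hp (fun s _ => by positivity) (by simp) (by simp) ?_ ?_ ?_
      (fun s hs t ht => hs.mem_profiles t ht) (fun s hs => hs.derivAtMost_pairs hu)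
      (fun s hs => hs.derivAtMost_dist hu hp)
    · refine continuousOn_finsetSum _ fun i _ => continuousOn_finsetSum _ fun j _ =>
        continuousOn_const.mul (((hg i).sub (hg j)).inner (by fun_prop))
    · exact continuousOn_finsetSum _ fun i _ =>
        continuousOn_const.mul ((hg i).inner (by fun_prop))
    · intro s _
      have h0 : 0 ≤ ∑ i, ‖s i - σ‖ ^ 2 := by positivity
      have h1 : dist s (fun _ => σ) ≤ Real.sqrt (∑ i, ‖s i - σ‖ ^ 2) := by
        refine (dist_pi_le_iff (Real.sqrt_nonneg _)).2 fun i => ?_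
        rw [dist_eq_norm]
        refine Real.le_sqrt_of_sq_le ?_
        exact Finset.single_le_sum (f := fun i => ‖s i - σ‖ ^ 2) (fun i _ => sq_nonneg _)
          (Finset.mem_univ i)
      calc dist s (fun _ => σ) ^ 2 ≤ Real.sqrt (∑ i, ‖s i - σ‖ ^ 2) ^ 2 := by gcongr
        _ = _ := Real.sq_sqrt h0
    · intro s hs hpos
      have hle : ∀ i j, 2 * ⟪profileGradient u s i - profileGradient u s j, s i - s j⟫ ≤ 0 := by
        intro i j
        by_cases hij : s i = s j
        · simp [hij]
        · linarith [inner_profileGradient_sub_neg hu hdiv hs hij]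
      obtain ⟨i, j, hij⟩ : ∃ i j, s i ≠ s j := by
        by_contra! hall
        simp [fun i j => sub_eq_zero.2 (hall i j)] at hpos
      refine Finset.sum_neg' (fun i _ => Finset.sum_nonpos fun j _ => hle i j)
        ⟨i, Finset.mem_univ i, Finset.sum_neg' (fun j _ => hle i j) ⟨j, Finset.mem_univ j, ?_⟩⟩
      linarith [inner_profileGradient_sub_neg hu hdiv hs hij]
    · intro s hs hzero hpos
      have hne : s ≠ fun _ => σ := by
        rintro rfl
        simp at hpos
      exact Finset.sum_neg
        (fun i _ => by linarith [hW s hs (hpair s hzero) hne i]) Finset.univ_nonempty
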